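/- **First order Newton–Puiseux theorem.** *Conventions.* Let $\mathscr C$ be the ring of germs at $0^+$ of continuous functions $f:(0,\epsilon_0)\to\mathbb C$ (for some $\epsilon_0>0$) such that $|f(\epsilon)|\le \epsilon^{-k}$ on $(0,\epsilon_0)$ for some constant $k>0$. The exponent of $f\in\mathscr C$ is $\mathsf e(f)=\liminf_{\epsilon\to0^+}\log|f(\epsilon)|/\log\epsilon\in\mathbb R\cup\{+\infty\}$, where the quotient is $+\infty$ when $f(\epsilon)=0$. Let $\mathbb R_{\min}=\mathbb R\cup\{+\infty\}$ be the min-plus semiring, with addition $a\oplus b=\min(a,b)$, multiplication $ab=a+b$, zero $+\infty$ and unit $0$. For $f\in\mathscr C$, $a\in\mathbb C$, $A\in\mathbb R_{\min}$, write $f\simeq a\epsilon^A$ if $A\in\mathbb R$ and $\lim_{\epsilon\to0^+}\epsilon^{-A}f(\epsilon)=a$, or $A=+\infty$ and $f=0$ in $\mathscr C$; write $f\sim a\epsilon^A$ if $f\simeq a\epsilon^A$ and moreover $a\ne0$ or $A=+\infty$. For a formal polynomial $P=\bigoplus_j P_j\mathsf Y^j\in\mathbb R_{\min}[\mathsf Y]$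 let $\widehat P(y)=\min_j(P_j+jy)$ be its polynomial function. If $P$ has degree $n$, its sequence of min-plus roots is the unique sequence $c_1\le\dots\le c_n$ in $\mathbb R_{\min}$ such that $\widehat P(y)=P_n+\sum_{i=1}^n\min(y,c_i)$ for all $y\in\mathbb R_{\min}$. Let $\overline P$ be the formal polynomial whose $k$-th coefficient is the value at $k$ of the convex hull of the function on $\mathbb R$ equal to $P_j$ at each $j\in\mathbb N$ and to $+\infty$ elsewhere. For $\mathcal P=\sum_j\mathcal P_j\mathsf Y^j\in\mathscr C[\mathsf Y]$ let $\mathsf e(\mathcal P)=\bigoplus_j\mathsf e(\mathcal P_j)\mathsf Y^j\in\mathbb R_{\min}[\mathsf Y]$. *Theorem.* Let $n\ge 0$ and $\mathcal P=\sum_{j=0}^n\mathcal P_j\mathsf Y^j\in\mathscr C[\mathsf Y]$ with $\mathcal P_n=1$. The following assertions are equivalent. 1. There exist $\mathcal Y_1,\dots,\mathcal Y_n\in\mathscr C$, $y_1,\dots,y_n\in\mathbb C$ and $Y_1\le\dots\le Y_n$ in $\mathbb R_{\min}$ such that, for all small $\epsilon>0$, $\mathcal Y_1(\epsilon),\dots,\mathcal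 Y_n(\epsilon)$ are the roots of $\mathcal P(\epsilon,\cdot)$ counted with multiplicities, and $\mathcal Y_j\sim y_j\epsilon^{Y_j}$ for all $j$. 2. There exist $p=\sum_{j=0}^n p_j\mathsf Y^j\in\mathbb C[\mathsf Y]$ and $P=\bigoplus_{j=0}^nP_j\mathsf Y^j\in\mathbb R_{\min}[\mathsf Y]$ with $\mathcal P_j\simeq p_j\epsilon^{P_j}$ for $j=0,\dots,n$, such that $p_n=1$, $P_n=0$ (the min-plus unit), $p_0\ne0$ or $P_0=+\infty$, and $p_{n-i}\ne0$ for all $i\in\{1,\dots,n-1\}$ with $c_i<c_{i+1}$, where $c_1\le\dots\le c_n$ are the min-plus roots of $P$. When these assertions hold, then for all data $(\mathcal Y_j,y_j,Y_j)_j$ as in 1 and all $(p,P)$ as in 2: $\mathsf e(\mathcal P)\ge P$ coefficientwise, $\overline{\mathsf e(\mathcal P)}=\overline P$, and both $\mathsf e(\mathcal P)$ and $P$ have $(c_1,\dots,c_n)=(Y_1,\dots,Y_n)$ as their sequence of min-plus roots. Moreover, if $c\in\mathbb R$ is a min-plus root of $P$ with multiplicity $k$ and $c_i=\dots=c_{i+k-1}=c$,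 then $y_i,\dots,y_{i+k-1}$ are precisely the non-zero roots, counted with multiplicities, of the complex polynomial $$p^{(i)}=\sum_{0\le j\le n,\ \widehat P(c)=P_j+jc}p_j\mathsf Y^j .$$ -/

import Mathlib

open Filter Topology Polynomial

noncomputable section

namespace NewtonPuiseux

/-! ### The ring of germs of continuous functions with moderate growth -/

/-- The ring of germs at `0⁺` of the continuous functions `g : (0, ε₀) → ℂ` such that
`|g ε| ≤ ε ^ (-k)` on `(0, ε₀)` for some constant `k > 0`. -/
def ModGerm : Subring (Germ (𝓝[>] (0 : ℝ)) ℂ) where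
  carrier := {f | ∃ (g : ℝ → ℂ) (ε₀ k : ℝ), 0 < ε₀ ∧ 0 < k ∧ ContinuousOn g (Set.Ioo 0 ε₀) ∧
    (∀ ε ∈ Set.Ioo 0 ε₀, ‖g ε‖ ≤ ε ^ (-k)) ∧ (g : Germ (𝓝[>] (0 : ℝ)) ℂ) = f}
  mul_mem' := by
    rintro _ _ ⟨g, a, k, ha, hk, hg, hgk, rfl⟩ ⟨h, b, l, hb, hl, hh, hhl, rfl⟩
    refine ⟨g * h, min a b, k + l, lt_min ha hb, add_pos hk hl, ?_, ?_, rfl⟩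
    · exact (hg.mono (Set.Ioo_subset_Ioo_right (min_le_left _ _))).mul
        (hh.mono (Set.Ioo_subset_Ioo_right (min_le_right _ _)))
    · intro ε hε
      have h1 := hgk ε ⟨hε.1, hε.2.trans_le (min_le_left _ _)⟩
      have h2 := hhl ε ⟨hε.1, hε.2.trans_le (min_le_right _ _)⟩
      rw [neg_add, Real.rpow_add hε.1, Pi.mul_apply, norm_mul]
      exact mul_le_mul h1 h2 (norm_nonneg _) (Real.rpow_nonneg hε.1.le _)
  one_mem' := by
    refine ⟨1, 1, 1, one_pos, one_pos, continuousOn_const, ?_, rfl⟩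
    intro ε hε
    rw [Pi.one_apply, norm_one]
    exact Real.one_le_rpow_of_pos_of_le_one_of_nonpos hε.1 hε.2.le (by norm_num)
  zero_mem' := by
    refine ⟨0, 1, 1, one_pos, one_pos, continuousOn_const, ?_, rfl⟩
    intro ε hε
    rw [Pi.zero_apply, norm_zero]
    exact Real.rpow_nonneg hε.1.le _
  add_mem' := by
    rintro _ _ ⟨g, a, k, ha, hk, hg, hgk, rfl⟩ ⟨h, b, l, hb, hl, hh, hhl, rfl⟩
    refine ⟨g + h, min (min a b) (1 / 2), k + l + 1, by positivity, by positivity, ?_, ?_, rfl⟩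
    · exact (hg.mono (Set.Ioo_subset_Ioo_right ((min_le_left _ _).trans (min_le_left _ _)))).add
        (hh.mono (Set.Ioo_subset_Ioo_right ((min_le_left _ _).trans (min_le_right _ _))))
    · intro ε hε
      have hε0 := hε.1
      have hε2 : ε ≤ 1 / 2 := hε.2.le.trans (min_le_right _ _)
      have h1 := hgk ε ⟨hε0, hε.2.trans_le ((min_le_left _ _).trans (min_le_left _ _))⟩
      have h2 := hhl ε ⟨hε0, hε.2.trans_le ((min_le_left _ _).trans (min_le_right _ _))⟩
      have h3 : ε ^ (-k) ≤ ε ^ (-(k + l)) :=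
        Real.rpow_le_rpow_of_exponent_ge hε0 (by linarith) (by linarith)
      have h4 : ε ^ (-l) ≤ ε ^ (-(k + l)) :=
        Real.rpow_le_rpow_of_exponent_ge hε0 (by linarith) (by linarith)
      have h5 : 2 ≤ ε ^ (-1 : ℝ) := by
        rw [Real.rpow_neg_one, le_inv_comm₀ two_pos hε0]
        linarith
      have h6 : (0 : ℝ) ≤ ε ^ (-(k + l)) := Real.rpow_nonneg hε0.le _
      rw [neg_add (k + l), Real.rpow_add hε0, Pi.add_apply]
      calc ‖g ε + h ε‖ ≤ ‖g ε‖ + ‖h ε‖ := norm_add_le _ _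
        _ ≤ ε ^ (-(k + l)) * 2 := by linarith
        _ ≤ _ := mul_le_mul_of_nonneg_left h5 h6
  neg_mem' := by
    rintro _ ⟨g, a, k, ha, hk, hg, hgk, rfl⟩
    refine ⟨-g, a, k, ha, hk, hg.neg, ?_, rfl⟩
    intro ε hε
    rw [Pi.neg_apply, norm_neg]
    exact hgk ε hε

/-- A representative of a germ. It is only used through properties that hold for all small
`ε > 0`, which do not depend on the choice. -/
def germVal (f : ModGerm) : ℝ → ℂ := Quotient.out f.1

theorem coe_germVal (f : ModGerm) : (germVal f : Germ (𝓝[>] (0 : ℝ)) ℂ) = f.1 := Quotient.out_eq f.1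

theorem germVal_eventuallyEq (f : ModGerm) (g : ℝ → ℂ)
    (h : (g : Germ (𝓝[>] (0 : ℝ)) ℂ) = f.1) : germVal f =ᶠ[𝓝[>] (0 : ℝ)] g :=
  Germ.coe_eq.1 ((coe_germVal f).trans h.symm)

theorem eq_zero_iff (f : ModGerm) : f = 0 ↔ ∀ᶠ ε in 𝓝[>] (0 : ℝ), germVal f ε = 0 := by
  rw [← Subtype.coe_inj, ← coe_germVal f]
  exact Germ.coe_eq

/-! ### Exponents and first order asymptotics -/

/-- The min-plus semiring `ℝ ∪ {+∞}`, with `min` as addition and `+` as multiplication.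
Its zero is `+∞`, its unit is the real number `0`, and its order is the usual one. -/
abbrev Rmin : Type := Tropical (WithTop ℝ)

/-- A real number as an element of the min-plus semiring. -/
def ofReal (r : ℝ) : Rmin := Tropical.trop (r : WithTop ℝ)

/-- The inclusion of `ℝ ∪ {+∞}` in the extended reals. -/
def toEReal (a : Rmin) : EReal := ((Tropical.untrop a : WithTop ℝ) : WithBot (WithTop ℝ))

/-- An extended real number other than `-∞` as an element of the min-plus semiring. -/
def ofEReal (x : EReal) (h : x ≠ ⊥) : Rmin := Tropical.trop (WithBot.unbot (α := WithTop ℝ) x h)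

theorem toEReal_ofEReal (x : EReal) (h : x ≠ ⊥) : toEReal (ofEReal x h) = x :=
  WithBot.coe_unbot (α := WithTop ℝ) x h

theorem toEReal_injective : Function.Injective toEReal := fun _ _ h =>
  Tropical.untrop_injective (WithBot.coe_injective h)

theorem toEReal_zero : toEReal 0 = ⊤ := rfl

theorem toEReal_ofReal (r : ℝ) : toEReal (ofReal r) = (r : EReal) := rfl

theorem toEReal_ne_bot (a : Rmin) : toEReal a ≠ ⊥ := WithBot.coe_ne_bot

/-- `log |z| / log ε`, with the value `+∞` at `z = 0` (for `0 < ε < 1`). -/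
def logRatio (z : ℂ) (ε : ℝ) : EReal :=
  open Classical in if z = 0 then ⊤ else ((Real.log ‖z‖ / Real.log ε : ℝ) : EReal)

/-- `liminf_{ε → 0⁺} log |f ε| / log ε`, in the extended reals. -/
def exponentE (f : ModGerm) : EReal := liminf (fun ε => logRatio (germVal f ε) ε) (𝓝[>] (0 : ℝ))

theorem exponentE_ne_bot (f : ModGerm) : exponentE f ≠ ⊥ := by
  obtain ⟨g, a, k, ha, hk, -, hgk, hg⟩ := f.2
  have key : ((-k : ℝ) : EReal) ≤ exponentE f := by
    refine le_liminf_of_le (by isBoundedDefault) ?_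
    have h1 : Set.Ioo (0 : ℝ) (min a 1) ∈ 𝓝[>] (0 : ℝ) := Ioo_mem_nhdsGT (lt_min ha one_pos)
    filter_upwards [germVal_eventuallyEq f g hg, h1] with ε hε hI
    rw [hε, logRatio]
    split_ifs with h0
    · exact le_top
    · have hlog : Real.log ε < 0 := Real.log_neg hI.1 (hI.2.trans_le (min_le_right _ _))
      have h2 : Real.log ‖g ε‖ ≤ -k * Real.log ε := by
        rw [← Real.log_rpow hI.1]
        exact Real.log_le_log (norm_pos_iff.2 h0)
          (hgk ε ⟨hI.1, hI.2.trans_le (min_le_left _ _)⟩)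
      exact EReal.coe_le_coe_iff.2 ((le_div_iff_of_neg hlog).2 h2)
  intro h
  rw [h] at key
  exact absurd (le_bot_iff.1 key) (EReal.coe_ne_bot _)

/-- The exponent of a germ `f`: the liminf of `log |f ε| / log ε`, an element of `ℝ ∪ {+∞}`. -/
def exponent (f : ModGerm) : Rmin := ofEReal (exponentE f) (exponentE_ne_bot f)

theorem exponent_zero : exponent 0 = 0 := by
  apply toEReal_injective
  rw [exponent, toEReal_ofEReal, toEReal_zero, exponentE]
  have h : (fun ε => logRatio (germVal 0 ε) ε) =ᶠ[𝓝[>] (0 : ℝ)] fun _ => ⊤ := by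
    filter_upwards [(eq_zero_iff 0).1 rfl] with ε hε
    rw [hε, logRatio, if_pos rfl]
  rw [liminf_congr h, liminf_const]

/-- `f ε ∼ a ε ^ A`: either `A` is real, `a ≠ 0` and `ε ^ (-A) f ε → a` as `ε → 0⁺`, or `A = +∞`
and `f` is the germ `0`. -/
def HasFirstOrderAsymptotics (f : ModGerm) (a : ℂ) (A : Rmin) : Prop :=
  (A = 0 ∧ f = 0) ∨ ∃ r : ℝ, A = ofReal r ∧ a ≠ 0 ∧
    Tendsto (fun ε : ℝ => ((ε ^ (-r) : ℝ) : ℂ) * germVal f ε) (𝓝[>] 0) (𝓝 a)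

/-- `f ε ≃ a ε ^ A`, that is `f ε = a ε ^ A + o(ε ^ A)`, where `a = 0` is allowed: either `A` is
real and `ε ^ (-A) f ε → a` as `ε → 0⁺`, or `A = +∞` and `f` is the germ `0`. -/
def HasWeakEquivalent (f : ModGerm) (a : ℂ) (A : Rmin) : Prop :=
  (A = 0 ∧ f = 0) ∨ ∃ r : ℝ, A = ofReal r ∧
    Tendsto (fun ε : ℝ => ((ε ^ (-r) : ℝ) : ℂ) * germVal f ε) (𝓝[>] 0) (𝓝 a)

/-- The complex polynomial `𝒫(ε, ·)` for a polynomial `𝒫` with germs as coefficients. -/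
def evalAt (Q : ModGerm[X]) (ε : ℝ) : ℂ[X] :=
  ∑ j ∈ Finset.range (Q.natDegree + 1), monomial j (germVal (Q.coeff j) ε)

/-- The min-plus polynomial of exponents `⨁ⱼ e(𝒫ⱼ) Yʲ`. -/
def exponentPoly (Q : ModGerm[X]) : Rmin[X] :=
  ∑ j ∈ Finset.range (Q.natDegree + 1), monomial j (exponent (Q.coeff j))

theorem coeff_exponentPoly (Q : ModGerm[X]) (j : ℕ) :
    (exponentPoly Q).coeff j = exponent (Q.coeff j) := by
  rw [exponentPoly, finsetSum_coeff]
  simp only [coeff_monomial, Finset.sum_ite_eq', Finset.mem_range]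
  split_ifs with h
  · rfl
  · rw [coeff_eq_zero_of_natDegree_lt (by omega), exponent_zero]

/-! ### Min-plus polynomials: roots and convex hull -/

/-- `c₁ ≤ ⋯ ≤ cₙ` is the sequence of min-plus roots of the formal polynomial `P` of degree `n`:
the polynomial function of `P` is `y ↦ Pₙ (y ⊕ c₁) ⋯ (y ⊕ cₙ)`. -/
structure IsMinPlusRoots {n : ℕ} (P : Rmin[X]) (c : Fin n → Rmin) : Prop where
  degree_eq : P.degree = n
  monotone : Monotone c
  eval_eq : ∀ y : Rmin, P.eval y = P.coeff n * ∏ i, (y + c i)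

/-- The convex hull of a function `f : ℝ → [-∞, +∞]`: the function whose epigraph is bounded
below by the convex hull of the epigraph of `f`. -/
def vex (f : ℝ → EReal) (x : ℝ) : EReal :=
  sInf ((fun r : ℝ => (r : EReal)) ''
    {r : ℝ | (x, r) ∈ convexHull ℝ {q : ℝ × ℝ | f q.1 ≤ (q.2 : EReal)}})

/-- A formal min-plus polynomial as a function on `ℝ`, equal to `+∞` outside `ℕ`. -/
def toFun (P : Rmin[X]) (x : ℝ) : EReal :=
  open Classical in if x = (⌊x⌋₊ : ℝ) then toEReal (P.coeff ⌊x⌋₊) else ⊤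

theorem toFun_natCast (P : Rmin[X]) (k : ℕ) : toFun P k = toEReal (P.coeff k) := by
  simp [toFun]

theorem toFun_of_ne (P : Rmin[X]) (x : ℝ) (h : ∀ k : ℕ, x ≠ k) : toFun P x = ⊤ := by
  simp [toFun, h]

theorem exists_of_toFun_le (P : Rmin[X]) (x r : ℝ) (h : toFun P x ≤ r) :
    ∃ k ≤ P.natDegree, x = (k : ℝ) ∧ toEReal (P.coeff k) ≤ r := by
  by_cases hx : ∃ k : ℕ, x = k
  · obtain ⟨k, rfl⟩ := hx
    rw [toFun_natCast] at h
    refine ⟨k, ?_, rfl, h⟩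
    by_contra hk
    rw [coeff_eq_zero_of_natDegree_lt (not_le.1 hk), toEReal_zero, top_le_iff] at h
    exact EReal.coe_ne_top _ h
  · push Not at hx
    rw [toFun_of_ne P x hx, top_le_iff] at h
    exact absurd h (EReal.coe_ne_top _)

theorem vex_toFun_ne_bot (P : Rmin[X]) (x : ℝ) : vex (toFun P) x ≠ ⊥ := by
  have hm : ∃ m : ℝ, ∀ k ≤ P.natDegree, (m : EReal) ≤ toEReal (P.coeff k) := by
    have h1 : ∀ k, ∃ m : ℝ, (m : EReal) ≤ toEReal (P.coeff k) := by
      intro k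
      obtain ⟨m, -, hm⟩ := EReal.lt_iff_exists_real_btwn.1
        (bot_lt_iff_ne_bot.2 (toEReal_ne_bot (P.coeff k)))
      exact ⟨m, hm.le⟩
    choose m hm using h1
    obtain ⟨b, hb⟩ := ((Finset.range (P.natDegree + 1)).image m).bddBelow
    refine ⟨b, fun k hk => le_trans (EReal.coe_le_coe_iff.2 (hb ?_)) (hm k)⟩
    exact Finset.mem_coe.2 (Finset.mem_image_of_mem m (Finset.mem_range.2 (by omega)))
  obtain ⟨m, hm⟩ := hm
  have hsub : convexHull ℝ {q : ℝ × ℝ | toFun P q.1 ≤ (q.2 : EReal)} ⊆ {q | m ≤ q.2} := by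
    refine convexHull_min ?_ (convex_halfSpace_ge (LinearMap.snd ℝ ℝ ℝ).isLinear m)
    rintro ⟨a, b⟩ h
    obtain ⟨k, hk, -, h2⟩ := exists_of_toFun_le P a b h
    exact EReal.coe_le_coe_iff.1 ((hm k hk).trans h2)
  have key : (m : EReal) ≤ vex (toFun P) x := by
    refine le_sInf ?_
    rintro _ ⟨r, hr, rfl⟩
    exact EReal.coe_le_coe_iff.2 (hsub hr)
  intro h
  rw [h] at key
  exact absurd (le_bot_iff.1 key) (EReal.coe_ne_bot _)

/-- The convex formal polynomial of `P`, whose `k`-th coefficient is the value at `k` of the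
convex hull of the function `toFun P`. -/
def divex (P : Rmin[X]) : Rmin[X] :=
  ∑ k ∈ Finset.range (P.natDegree + 1),
    monomial k (ofEReal (vex (toFun P) k) (vex_toFun_ne_bot P k))

theorem toEReal_coeff_divex (P : Rmin[X]) (k : ℕ) :
    toEReal ((divex P).coeff k) = vex (toFun P) k := by
  rw [divex, finsetSum_coeff]
  simp only [coeff_monomial, Finset.sum_ite_eq', Finset.mem_range]
  split_ifs with h
  · exact toEReal_ofEReal _ _
  · have hsub : convexHull ℝ {q : ℝ × ℝ | toFun P q.1 ≤ (q.2 : EReal)} ⊆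
        {q | q.1 ≤ P.natDegree} := by
      refine convexHull_min ?_ (convex_halfSpace_le (LinearMap.fst ℝ ℝ ℝ).isLinear _)
      rintro ⟨a, b⟩ h
      obtain ⟨j, hj, rfl, -⟩ := exists_of_toFun_le P a b h
      exact (Nat.cast_le (α := ℝ)).2 hj
    rw [toEReal_zero, vex]
    symm
    rw [sInf_eq_top]
    rintro _ ⟨r, hr, rfl⟩
    have : (k : ℝ) ≤ P.natDegree := hsub hr
    exact absurd ((Nat.cast_le (α := ℝ)).1 this) (by omega)

/-- The polynomial `∑ pⱼ Yʲ` over the `j ≤ n` at which the minimum `P(c) = minⱼ (Pⱼ + j c)` is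
attained, that is `P(c) = Pⱼ cʲ` in the min-plus semiring. -/
def saturated (n : ℕ) (p : ℂ[X]) (P : Rmin[X]) (c : Rmin) : ℂ[X] :=
  open Classical in
  ∑ j ∈ (Finset.range (n + 1)).filter (fun j => P.eval c = P.coeff j * c ^ j),
    monomial j (p.coeff j)

/-! ### The two assertions -/

/-- The germs `𝒴₁, …, 𝒴ₙ` are the roots of `Q`, counted with multiplicities, and
`𝒴ⱼ ε ∼ yⱼ ε ^ Yⱼ` with `Y₁ ≤ ⋯ ≤ Yₙ`. -/
structure RootsWithAsymptotics {n : ℕ} (Q : ModGerm[X]) (rt : Fin n → ModGerm)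
    (y : Fin n → ℂ) (Y : Fin n → Rmin) : Prop where
  roots_eq : ∀ᶠ ε in 𝓝[>] (0 : ℝ),
    (evalAt Q ε).roots = Finset.univ.val.map (fun j => germVal (rt j) ε)
  asymptotics : ∀ j, HasFirstOrderAsymptotics (rt j) (y j) (Y j)
  monotone : Monotone Y

/-- The coefficients of `Q` satisfy `Qⱼ ε ≃ pⱼ ε ^ Pⱼ` for `0 ≤ j ≤ n`, where `pₙ = 1`, `Pₙ = 0`
(the min-plus unit), `p₀ ≠ 0` or `P₀ = +∞`, and `p_{n-i} ≠ 0` for all `1 ≤ i ≤ n - 1` such that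
`cᵢ < cᵢ₊₁`, where `c₁ ≤ ⋯ ≤ cₙ` are the min-plus roots of `P`. The sequence `c` is indexed from
`0` in the code. -/
structure CoeffsWithEquivalents {n : ℕ} (Q : ModGerm[X]) (p : ℂ[X]) (P : Rmin[X])
    (c : Fin n → Rmin) : Prop where
  natDegree_le : p.natDegree ≤ n
  natDegree_le' : P.natDegree ≤ n
  equivalent : ∀ j ≤ n, HasWeakEquivalent (Q.coeff j) (p.coeff j) (P.coeff j)
  lead : p.coeff n = 1
  lead' : P.coeff n = 1
  zero : p.coeff 0 ≠ 0 ∨ P.coeff 0 = 0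
  roots : IsMinPlusRoots P c
  break_ne : ∀ (i : ℕ) (h1 : 1 ≤ i) (h2 : i < n),
    c ⟨i - 1, by omega⟩ < c ⟨i, h2⟩ → p.coeff (n - i) ≠ 0

end NewtonPuiseux

end

open NewtonPuiseux

noncomputable section

namespace NewtonPuiseux

/-! ### Real computations in the min-plus semiring -/

/-! Everything is read off at a scale `ε ^ v`. Put `Y = ε ^ v z` in the polynomial and multiply by
`ε ^ (-∑ᵢ min (v, cᵢ))`. In terms of the coefficients, the limit is the saturated polynomial at `v`:
the terms outside the minimum vanish. In terms of the roots, with `Yᵢ` in place of `cᵢ`, the limit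
is a product of factors `z`, `z - yᵢ` or `-yᵢ` according to whether `Yᵢ` is greater than, equal to
or less than `v`. Both limits are nonzero polynomials, so the two normalizations agree for every
`v`, which gives `c = Y`, and the limits agree, which identifies the `yᵢ` with `Yᵢ = v` as the
nonzero roots of the saturated polynomial (`rootSum_eq_and_saturated_eq`).

From roots to coefficients, Viète's formulas are used: at an index where the sequence of exponents
jumps, a single product of roots has the smallest exponent, so nothing cancels (`prod_lowSet_lt`).

From coefficients to roots, three facts are combined. The roots can be chosen as continuous germs,
after a rescaling that makes the coefficients continuous up to `0` (`exists_root_germs`). Every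
nonzero root has size comparable to some `ε ^ cᵢ`, since elsewhere one term of the polynomial
dominates (`exists_magnitude`). Finally a continuous branch cannot jump between disjoint annuli, nor
between small balls around the roots of the saturated polynomial, so it converges after rescaling
(`exists_asymptotics`).

The hypothesis on `p` says that it does not vanish at the vertices of the Newton polygon. There the
exponents of the coefficients equal `P`, and elsewhere they are at least `P`; hence both have the
same polygon. -/

theorem eq_zero_or_eq_ofReal (a : Rmin) : a = 0 ∨ ∃ r : ℝ, a = ofReal r := by
  induction a using Tropical.tropRec with
  | h x =>
    induction x using WithTop.recTopCoe with
    | top => exact Or.inl rfl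
    | coe r => exact Or.inr ⟨r, rfl⟩

theorem ofReal_ne_zero (r : ℝ) : ofReal r ≠ 0 := Tropical.trop_coe_ne_zero r

theorem ofReal_inj {a b : ℝ} : ofReal a = ofReal b ↔ a = b := by
  rw [ofReal, ofReal, Tropical.trop_inj_iff, WithTop.coe_inj]

theorem ofReal_le {a b : ℝ} : ofReal a ≤ ofReal b ↔ a ≤ b := by
  rw [ofReal, ofReal, ← Tropical.untrop_le_iff]
  exact WithTop.coe_le_coe

theorem ofReal_lt {a b : ℝ} : ofReal a < ofReal b ↔ a < b := by
  rw [ofReal, ofReal, ← Tropical.untrop_lt_iff]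
  exact WithTop.coe_lt_coe

theorem ofReal_lt_zero (a : ℝ) : ofReal a < 0 :=
  lt_of_le_of_ne (Tropical.le_zero _) (ofReal_ne_zero a)

theorem ofReal_zero : ofReal 0 = 1 := rfl

theorem ofReal_add (a b : ℝ) : ofReal (a + b) = ofReal a * ofReal b := rfl

theorem ofReal_min (a b : ℝ) : ofReal (min a b) = ofReal a + ofReal b := rfl

theorem ofReal_natCast_mul (n : ℕ) (a : ℝ) : ofReal (n * a) = ofReal a ^ n := by
  induction n with
  | zero => simp [ofReal_zero]
  | succ n ih => rw [pow_succ, ← ih, ← ofReal_add]; congr 1; push_cast; ring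

theorem ofReal_sum {ι : Type*} (s : Finset ι) (f : ι → ℝ) :
    ofReal (∑ i ∈ s, f i) = ∏ i ∈ s, ofReal (f i) := by
  classical
  induction s using Finset.induction_on with
  | empty => simp [ofReal_zero]
  | insert a s ha ih => rw [Finset.sum_insert ha, Finset.prod_insert ha, ofReal_add, ih]

theorem toEReal_le {a b : Rmin} : toEReal a ≤ toEReal b ↔ a ≤ b := by
  rw [toEReal, toEReal, ← Tropical.untrop_le_iff]
  exact WithBot.coe_le_coe

theorem mul_le_mul_of_le {a b c d : Rmin} (h : a ≤ b) (h' : c ≤ d) : a * c ≤ b * d :=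
  mul_le_mul' h h'

theorem sum_le_of_mem {ι : Type*} {s : Finset ι} (f : ι → Rmin) {i : ι} (hi : i ∈ s) :
    ∑ j ∈ s, f j ≤ f i := by
  rw [← Tropical.untrop_le_iff, Finset.untrop_sum']
  exact Finset.inf_le hi

theorem exists_sum_eq {ι : Type*} {s : Finset ι} (hs : s.Nonempty) (f : ι → Rmin) :
    ∃ i ∈ s, ∑ j ∈ s, f j = f i := by
  obtain ⟨i, hi, h⟩ := Finset.exists_mem_eq_inf s hs (Tropical.untrop ∘ f)
  refine ⟨i, hi, Tropical.untrop_injective ?_⟩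
  rw [Finset.untrop_sum', h, Function.comp_apply]

theorem eval_le_coeff_mul_pow (P : Rmin[X]) (y : Rmin) (j : ℕ) :
    P.eval y ≤ P.coeff j * y ^ j := by
  by_cases hj : j < P.natDegree + 1
  · rw [eval_eq_sum_range]
    exact sum_le_of_mem (fun j => P.coeff j * y ^ j) (Finset.mem_range.2 hj)
  · rw [coeff_eq_zero_of_natDegree_lt (by omega), zero_mul]
    exact Tropical.le_zero _

theorem exists_eval_eq (P : Rmin[X]) (y : Rmin) :
    ∃ j ≤ P.natDegree, P.eval y = P.coeff j * y ^ j := by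
  obtain ⟨i, hi, h⟩ := exists_sum_eq (Finset.nonempty_range_add_one (n := P.natDegree))
    (fun j => P.coeff j * y ^ j)
  exact ⟨i, by simpa [Nat.lt_succ_iff] using hi, by rw [eval_eq_sum_range, h]⟩

/-- The real number `min (v, c)`. -/
def minReal (v : ℝ) (c : Rmin) : ℝ := (Tropical.untrop (ofReal v + c)).untopD 0

theorem minReal_zero (v : ℝ) : minReal v 0 = v := by
  rw [minReal, add_zero]; rfl

theorem minReal_ofReal (v r : ℝ) : minReal v (ofReal r) = min v r := rfl

theorem ofReal_minReal (v : ℝ) (c : Rmin) : ofReal (minReal v c) = ofReal v + c := by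
  rcases eq_zero_or_eq_ofReal c with rfl | ⟨r, rfl⟩
  · rw [minReal_zero, add_zero]
  · rw [minReal_ofReal, ofReal_min]

variable {n : ℕ}

/-- The real value `∑ᵢ min (v, cᵢ)` of the min-plus polynomial function with roots `c`. -/
def rootSum (c : Fin n → Rmin) (v : ℝ) : ℝ := ∑ i, minReal v (c i)

/-- The number of terms of the sequence `c` greater than `v`. -/
def countGT (c : Fin n → Rmin) (v : ℝ) : ℕ := (Finset.univ.filter (fun i => ofReal v < c i)).card

/-- The number of terms of the sequence `c` greater than or equal to `v`. -/
def countGE (c : Fin n → Rmin) (v : ℝ) : ℕ := (Finset.univ.filter (fun i => ofReal v ≤ c i)).card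

theorem countGT_le (c : Fin n → Rmin) (v : ℝ) : countGT c v ≤ n :=
  (Finset.card_le_univ _).trans_eq (Fintype.card_fin n)

theorem countGE_le (c : Fin n → Rmin) (v : ℝ) : countGE c v ≤ n :=
  (Finset.card_le_univ _).trans_eq (Fintype.card_fin n)

theorem minReal_of_gap {l x h : ℝ} (hl : l ≤ x) (hx : x ≤ h) {c : Rmin}
    (hc : ¬(ofReal l < c ∧ c < ofReal h)) :
    minReal x c = minReal l c + (if ofReal l < c then 1 else 0) * (x - l) := by
  rcases eq_zero_or_eq_ofReal c with rfl | ⟨r, rfl⟩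
  · rw [minReal_zero, minReal_zero, if_pos (ofReal_lt_zero l)]; ring
  · rw [minReal_ofReal, minReal_ofReal]
    rw [ofReal_lt, ofReal_lt] at hc
    simp only [ofReal_lt]
    split_ifs with h1
    · have : h ≤ r := not_lt.1 fun h2 => hc ⟨h1, h2⟩
      rw [min_eq_left (by linarith), min_eq_left (by linarith)]; ring
    · rw [min_eq_right (by linarith), min_eq_right (by linarith)]; ring

/-- Away from the roots each `min (x, cᵢ)` is constant or has slope `1`. The slope counts the roots
beyond the interval, a root equal to `l` contributing nothing. -/
theorem rootSum_of_gap (c : Fin n → Rmin) {l x h : ℝ} (hl : l ≤ x) (hx : x ≤ h)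
    (hc : ∀ i, ¬(ofReal l < c i ∧ c i < ofReal h)) :
    rootSum c x = rootSum c l + countGT c l * (x - l) := by
  rw [rootSum, rootSum, Finset.sum_congr rfl fun i _ => minReal_of_gap hl hx (hc i),
    Finset.sum_add_distrib, ← Finset.sum_mul, Finset.sum_boole, countGT]

theorem exists_gap_right (c : Fin n → Rmin) (v : ℝ) :
    ∃ h, v < h ∧ ∀ i, ¬(ofReal v < c i ∧ c i < ofReal h) := by
  have h1 : ∀ i, ∀ᶠ h in 𝓝[>] v, ¬(ofReal v < c i ∧ c i < ofReal h) := by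
    intro i
    rcases eq_zero_or_eq_ofReal (c i) with hi | ⟨r, hi⟩
    · exact .of_forall fun h hh => (hh.2.trans_le (Tropical.le_zero _)).ne (hi ▸ rfl) |>.elim
    · rw [hi]
      simp only [ofReal_lt]
      by_cases hr : v < r
      · filter_upwards [Ioo_mem_nhdsGT hr] with h hh hh'
        exact absurd hh.2 (not_lt.2 hh'.2.le)
      · exact .of_forall fun h hh => hr hh.1
  obtain ⟨h, hh, hv⟩ := ((eventually_all.2 h1).and self_mem_nhdsWithin).exists
  exact ⟨h, hv, hh⟩

theorem exists_gap_left (c : Fin n → Rmin) (v : ℝ) :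
    ∃ l, l < v ∧ ∀ i, ¬(ofReal l < c i ∧ c i < ofReal v) := by
  have h1 : ∀ i, ∀ᶠ l in 𝓝[<] v, ¬(ofReal l < c i ∧ c i < ofReal v) := by
    intro i
    rcases eq_zero_or_eq_ofReal (c i) with hi | ⟨r, hi⟩
    · exact .of_forall fun h hh => (hh.2.trans_le (Tropical.le_zero _)).ne (hi ▸ rfl) |>.elim
    · rw [hi]
      simp only [ofReal_lt]
      by_cases hr : r < v
      · filter_upwards [Ioo_mem_nhdsLT hr] with h hh hh'
        exact absurd hh.1 (not_lt.2 hh'.1.le)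
      · exact .of_forall fun h hh => hr hh.2
  obtain ⟨h, hh, hv⟩ := ((eventually_all.2 h1).and self_mem_nhdsWithin).exists
  exact ⟨h, hv, hh⟩

theorem countGT_eq_countGE (c : Fin n → Rmin) {l v : ℝ} (hl : l < v)
    (hc : ∀ i, ¬(ofReal l < c i ∧ c i < ofReal v)) : countGT c l = countGE c v := by
  rw [countGT, countGE]
  congr 1
  ext i
  simp only [Finset.mem_filter, Finset.mem_univ, true_and]
  exact ⟨fun h => not_lt.1 fun h' => hc i ⟨h, h'⟩, fun h => (ofReal_lt.2 hl).trans_le h⟩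

theorem rootSum_right (c : Fin n → Rmin) (v : ℝ) : ∃ h, v < h ∧ ∀ x, v ≤ x → x ≤ h →
    rootSum c x = rootSum c v + countGT c v * (x - v) := by
  obtain ⟨h, hv, hc⟩ := exists_gap_right c v
  exact ⟨h, hv, fun x h1 h2 => rootSum_of_gap c h1 h2 hc⟩

/-! ### Recovering a sorted sequence from its counting function -/

/-- In a sorted sequence the terms above `v` form a final segment, so their number determines which
they are. -/
theorem monotone_lt_iff {c : Fin n → Rmin} (hc : Monotone c) (v : ℝ) (i : Fin n) :
    ofReal v < c i ↔ n - (i : ℕ) ≤ countGT c v := by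
  constructor
  · intro h
    have : Finset.Ici i ⊆ Finset.univ.filter (fun i => ofReal v < c i) := by
      intro j hj
      simpa using h.trans_le (hc (Finset.mem_Ici.1 hj))
    simpa [countGT] using Finset.card_le_card this
  · intro h
    by_contra h'
    have : Finset.univ.filter (fun i => ofReal v < c i) ⊆ Finset.Ioi i := by
      intro j hj
      rw [Finset.mem_Ioi]
      by_contra hji
      exact h' ((Finset.mem_filter.1 hj).2.trans_le (hc (not_lt.1 hji)))
    have := Finset.card_le_card this
    rw [Fin.card_Ioi] at this
    rw [countGT] at h
    have := i.2
    omega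

theorem eq_of_countGT_eq {c d : Fin n → Rmin} (hc : Monotone c) (hd : Monotone d)
    (h : ∀ v, countGT c v = countGT d v) : c = d := by
  funext i
  have key : ∀ v, ofReal v < c i ↔ ofReal v < d i := fun v => by
    rw [monotone_lt_iff hc, monotone_lt_iff hd, h]
  rcases lt_trichotomy (c i) (d i) with h1 | h1 | h1
  · rcases eq_zero_or_eq_ofReal (c i) with h2 | ⟨r, h2⟩
    · exact absurd (Tropical.le_zero (d i)) (not_le.2 (h2 ▸ h1))
    · exact absurd ((key r).2 (h2 ▸ h1)) (h2 ▸ lt_irrefl _)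
  · exact h1
  · rcases eq_zero_or_eq_ofReal (d i) with h2 | ⟨r, h2⟩
    · exact absurd (Tropical.le_zero (c i)) (not_le.2 (h2 ▸ h1))
    · exact absurd ((key r).1 (h2 ▸ h1)) (h2 ▸ lt_irrefl _)

/-- The slope of `rootSum c` to the right of `v` is `countGT c v`, so the function determines all
the counts, and these determine a sorted sequence. -/
theorem eq_of_rootSum_eq {c d : Fin n → Rmin} (hc : Monotone c) (hd : Monotone d)
    (h : ∀ v, rootSum c v = rootSum d v) : c = d := by
  refine eq_of_countGT_eq hc hd fun v => ?_
  obtain ⟨x, hx, h1⟩ := rootSum_right c v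
  obtain ⟨y, hy, h2⟩ := rootSum_right d v
  have h3 := h1 (min x y) (le_min hx.le hy.le) (min_le_left _ _)
  have h4 := h2 (min x y) (le_min hx.le hy.le) (min_le_right _ _)
  rw [h, h4, h v, add_right_inj] at h3
  exact_mod_cast (mul_right_cancel₀ (sub_pos.2 (lt_min hx hy)).ne' h3).symm

/-! ### Min-plus polynomials in terms of their roots -/

namespace IsMinPlusRoots

variable {P : Rmin[X]} {c : Fin n → Rmin}

theorem natDegree_eq (h : IsMinPlusRoots P c) : P.natDegree = n :=
  natDegree_eq_of_degree_eq_some h.degree_eq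

theorem eval_ofReal (h : IsMinPlusRoots P c) (h1 : P.coeff n = 1) (v : ℝ) :
    P.eval (ofReal v) = ofReal (rootSum c v) := by
  rw [h.eval_eq, h1, one_mul, rootSum, ofReal_sum]
  exact Finset.prod_congr rfl fun i _ => (ofReal_minReal v (c i)).symm

theorem rootSum_le (h : IsMinPlusRoots P c) (h1 : P.coeff n = 1) {j : ℕ} {a : ℝ}
    (ha : P.coeff j = ofReal a) (v : ℝ) : rootSum c v ≤ a + j * v := by
  have := eval_le_coeff_mul_pow P (ofReal v) j
  rwa [h.eval_ofReal h1, ha, ← ofReal_natCast_mul, ← ofReal_add, ofReal_le] at this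

theorem exists_rootSum_eq (h : IsMinPlusRoots P c) (h1 : P.coeff n = 1) (v : ℝ) :
    ∃ j ≤ n, ∃ a, P.coeff j = ofReal a ∧ rootSum c v = a + j * v := by
  obtain ⟨j, hj, h2⟩ := exists_eval_eq P (ofReal v)
  rw [h.natDegree_eq] at hj
  refine ⟨j, hj, ?_⟩
  rcases eq_zero_or_eq_ofReal (P.coeff j) with h3 | ⟨a, h3⟩
  · rw [h3, zero_mul, h.eval_ofReal h1] at h2
    exact absurd h2 (ofReal_ne_zero _)
  · refine ⟨a, h3, ?_⟩
    rwa [h.eval_ofReal h1, h3, ← ofReal_natCast_mul, ← ofReal_add, ofReal_inj] at h2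

/-- On the gap the polynomial function is affine. A term attaining the minimum at the midpoint is an
affine function above it that touches it at an interior point, hence coincides with it; its slope is
its index. -/
theorem coeff_of_gap (h : IsMinPlusRoots P c) (h1 : P.coeff n = 1) {l u : ℝ} (hlu : l < u)
    (hc : ∀ i, ¬(ofReal l < c i ∧ c i < ofReal u)) :
    P.coeff (countGT c l) = ofReal (rootSum c l - countGT c l * l) := by
  obtain ⟨j, hj, a, ha, h2⟩ := h.exists_rootSum_eq h1 ((l + u) / 2)
  have h3 := rootSum_of_gap c (x := (l + u) / 2) (by linarith) (by linarith) hc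
  have h4 := rootSum_of_gap c (x := u) (by linarith) (by linarith) hc
  have h5 := h.rootSum_le h1 ha l
  have h6 := h.rootSum_le h1 ha u
  have h7 : (j : ℝ) = countGT c l := by
    apply le_antisymm
    · by_contra hlt
      nlinarith [mul_pos (sub_pos.2 hlu) (sub_pos.2 (not_le.1 hlt))]
    · by_contra hlt
      nlinarith [mul_pos (sub_pos.2 hlu) (sub_pos.2 (not_le.1 hlt))]
  have h8 : j = countGT c l := by exact_mod_cast h7
  rw [← h8, ha, ofReal_inj, h8]
  rw [h7] at h2
  linarith

end IsMinPlusRoots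

/-! ### Vertices of the Newton polygon -/

namespace CoeffsWithEquivalents

variable {Q : ModGerm[X]} {p : ℂ[X]} {P : Rmin[X]} {c : Fin n → Rmin}

/-- The index `countGT c v` is `0`, `n`, or a strict break of `c`, and each case is covered by one
clause of the definition. Finiteness of the coefficient of `P` matters only at index `0`. -/
theorem coeff_ne_zero (h : CoeffsWithEquivalents Q p P c) (v : ℝ)
    (hP : P.coeff (countGT c v) ≠ 0) : p.coeff (countGT c v) ≠ 0 := by
  have hle := countGT_le c v
  rcases Nat.eq_zero_or_pos (countGT c v) with h0 | h0
  · rw [h0] at hP ⊢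
    exact h.zero.resolve_right hP
  rcases hle.eq_or_lt with h1 | h1
  · rw [h1, h.lead]; exact one_ne_zero
  · have := h.break_ne (n - countGT c v) (by omega) (by omega) ?_
    · rwa [Nat.sub_sub_self hle] at this
    · refine lt_of_le_of_lt (b := ofReal v) (not_lt.1 ?_) ?_ <;>
        rw [monotone_lt_iff h.roots.monotone] <;> dsimp only <;> omega

theorem vertex_of_gap (h : CoeffsWithEquivalents Q p P c) {l u : ℝ} (hlu : l < u)
    (hc : ∀ i, ¬(ofReal l < c i ∧ c i < ofReal u)) :
    p.coeff (countGT c l) ≠ 0 ∧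
      P.coeff (countGT c l) = ofReal (rootSum c l - countGT c l * l) := by
  have h1 := h.roots.coeff_of_gap h.lead' hlu hc
  exact ⟨h.coeff_ne_zero l (h1 ▸ ofReal_ne_zero _), h1⟩

/-- With `vertex_left`: the supporting line of slope `-v` meets the Newton polygon along an edge
with end indices `countGT c v` and `countGE c v`, which coincide when `v` is not a root. -/
theorem vertex_right (h : CoeffsWithEquivalents Q p P c) (v : ℝ) :
    p.coeff (countGT c v) ≠ 0 ∧
      P.coeff (countGT c v) = ofReal (rootSum c v - countGT c v * v) := by
  obtain ⟨u, hu, hc⟩ := exists_gap_right c v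
  exact h.vertex_of_gap hu hc

theorem vertex_left (h : CoeffsWithEquivalents Q p P c) (v : ℝ) :
    p.coeff (countGE c v) ≠ 0 ∧
      P.coeff (countGE c v) = ofReal (rootSum c v - countGE c v * v) := by
  obtain ⟨l, hl, hc⟩ := exists_gap_left c v
  have h1 := h.vertex_of_gap hl hc
  rw [rootSum_of_gap c hl.le le_rfl hc, ← countGT_eq_countGE c hl hc]
  refine ⟨h1.1, h1.2.trans ?_⟩
  congr 1; ring

end CoeffsWithEquivalents

/-! ### Continuous selection of the roots of a one-parameter family of polynomials -/

/-- The monic polynomial with roots `x₁, …, xₙ`. -/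
def rootPoly (x : Fin n → ℂ) : ℂ[X] := ∏ i, (X - C (x i))

theorem rootPoly_eval (x : Fin n → ℂ) (z : ℂ) : (rootPoly x).eval z = ∏ i, (z - x i) := by
  simp [rootPoly, eval_prod]

theorem rootPoly_monic (x : Fin n → ℂ) : (rootPoly x).Monic :=
  monic_prod_of_monic _ _ fun _ _ => monic_X_sub_C _

theorem rootPoly_natDegree (x : Fin n → ℂ) : (rootPoly x).natDegree = n := by
  simp [rootPoly]

theorem rootPoly_roots (x : Fin n → ℂ) : (rootPoly x).roots = Finset.univ.val.map x := by
  rw [rootPoly, Finset.prod_eq_multiset_prod, ← roots_multiset_prod_X_sub_C (Finset.univ.val.map x),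
    Multiset.map_map]
  rfl

/-- The fibres of `x` and `y` over each value have the same cardinality, the multiplicity of that
value; bijections between them are glued into a permutation. -/
theorem exists_perm_of_map_eq {α : Type*} {x y : Fin n → α}
    (h : Finset.univ.val.map x = Finset.univ.val.map y) : ∃ σ : Equiv.Perm (Fin n), x = y ∘ σ := by
  classical
  have key : ∀ v, Nonempty ({i // x i = v} ≃ {i // y i = v}) := by
    intro v
    refine ⟨Fintype.equivOfCardEq ?_⟩
    have h1 := congrArg (Multiset.count v) h
    rw [Multiset.count_map, Multiset.count_map] at h1
    rw [Fintype.card_subtype, Fintype.card_subtype, Finset.card_def, Finset.card_def]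
    simpa [Finset.filter_val, eq_comm] using h1
  refine ⟨(Equiv.sigmaFiberEquiv x).symm.trans
    ((Equiv.sigmaCongrRight fun v => (key v).some).trans (Equiv.sigmaFiberEquiv y)), ?_⟩
  funext i
  exact ((key (x i)).some ⟨i, rfl⟩).2.symm

theorem exists_perm_of_rootPoly_eq {x y : Fin n → ℂ} (h : rootPoly x = rootPoly y) :
    ∃ σ : Equiv.Perm (Fin n), x = y ∘ σ :=
  exists_perm_of_map_eq (by rw [← rootPoly_roots, h, rootPoly_roots])

theorem rootPoly_comp_perm (x : Fin n → ℂ) (σ : Equiv.Perm (Fin n)) :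
    rootPoly (x ∘ σ) = rootPoly x :=
  Equiv.prod_comp σ fun i => X - C (x i)

theorem exists_rootPoly_eq {q : ℂ[X]} (hq : q.Monic) (hn : q.natDegree = n) :
    ∃ x : Fin n → ℂ, rootPoly x = q := by
  have h1 := (IsAlgClosed.splits q).natDegree_eq_card_roots
  have h2 : q.roots.toList.length = n := by rw [Multiset.length_toList, ← h1, hn]
  refine ⟨fun i => q.roots.toList.get (i.cast h2.symm), ?_⟩
  have h3 := prod_multiset_X_sub_C_of_monic_of_roots_card_eq hq h1.symm
  rw [← Multiset.coe_toList q.roots, Multiset.map_coe, Multiset.prod_coe] at h3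
  refine Eq.trans ?_ h3
  clear h3
  generalize q.roots.toList = L at h2 ⊢
  subst h2
  rw [rootPoly, ← List.prod_ofFn]
  congr 1
  exact List.ext_get (by simp) (by simp)

/-- If `x` converges and `rootPoly x = q`, then the limits satisfy the same relation. -/
theorem rootPoly_eq_of_tendsto {ι : Type*} {l : Filter ι} [l.NeBot] {q : ℝ → ℂ[X]}
    (hq : ∀ z, Continuous fun t => (q t).eval z) {x : ι → Fin n → ℂ} {s : ι → ℝ}
    {x₀ : Fin n → ℂ} {s₀ : ℝ} (hx : Tendsto x l (𝓝 x₀)) (hs : Tendsto s l (𝓝 s₀))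
    (h : ∀ i, rootPoly (x i) = q (s i)) : rootPoly x₀ = q s₀ := by
  refine Polynomial.funext fun z => ?_
  refine tendsto_nhds_unique (f := fun i => (rootPoly (x i)).eval z) (l := l) ?_ ?_
  · simp only [rootPoly_eval]
    exact tendsto_finsetProd _ fun i _ => tendsto_const_nhds.sub (tendsto_pi_nhds.1 hx i)
  · simp only [h]
    exact ((hq z).tendsto s₀).comp hs

/-- Uniform matching of the roots at nearby parameters. -/
theorem exists_matching {q : ℝ → ℂ[X]} (hq : ∀ z, Continuous fun t => (q t).eval z) {K : Set ℝ}
    (hK : IsCompact K) {B : ℝ} (hB : ∀ t ∈ K, ∀ x : Fin n → ℂ, rootPoly x = q t → ‖x‖ ≤ B)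
    (hex : ∀ t ∈ K, ∃ x : Fin n → ℂ, rootPoly x = q t) {η : ℝ} (hη : 0 < η) :
    ∃ δ > 0, ∀ s ∈ K, ∀ t ∈ K, |s - t| < δ → ∀ x : Fin n → ℂ, rootPoly x = q s →
      ∃ y : Fin n → ℂ, rootPoly y = q t ∧ dist x y ≤ η := by
  by_contra! hcon
  -- A failure at every scale `1 / (m + 1)` yields parameters with `|s m - t m| → 0` and unmatched
  -- root tuples. Compactness gives limits `x₀`, `y₀` of the tuples at a common parameter `s₀`,
  -- which are permutations of each other.
  choose s hs t ht hst x hx hxy using fun m : ℕ => hcon (1 / ((m : ℝ) + 1)) (by positivity)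
  choose y hy using fun m => hex (t m) (ht m)
  have hZ := (hK.prod ((isCompact_closedBall (0 : Fin n → ℂ) B).prod
    (isCompact_closedBall (0 : Fin n → ℂ) B)))
  obtain ⟨⟨s₀, x₀, y₀⟩, -, φ, hφ, hlim⟩ := hZ.tendsto_subseq
    (x := fun m => (s m, x m, y m)) (fun m => ⟨hs m, by simpa using hB _ (hs m) _ (hx m),
      by simpa using hB _ (ht m) _ (hy m)⟩)
  rw [nhds_prod_eq, nhds_prod_eq, tendsto_prod_iff'] at hlim
  obtain ⟨hs0, hxy0⟩ := hlim
  rw [tendsto_prod_iff'] at hxy0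
  obtain ⟨hx0, hy0⟩ := hxy0
  have ht0 : Tendsto (t ∘ φ) atTop (𝓝 s₀) := by
    refine hs0.congr_dist ?_
    refine squeeze_zero (fun _ => dist_nonneg) (fun m => (hst (φ m)).le) ?_
    exact tendsto_one_div_add_atTop_nhds_zero_nat.comp hφ.tendsto_atTop
  have h1 : rootPoly x₀ = q s₀ := rootPoly_eq_of_tendsto hq hx0 hs0 fun m => hx (φ m)
  have h2 : rootPoly y₀ = q s₀ := rootPoly_eq_of_tendsto hq hy0 ht0 fun m => hy (φ m)
  obtain ⟨σ, hσ⟩ := exists_perm_of_rootPoly_eq (h1.trans h2.symm)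
  have h3 : Tendsto (fun m => (y (φ m)) ∘ σ) atTop (𝓝 x₀) := by
    rw [hσ]
    exact tendsto_pi_nhds.2 fun i => tendsto_pi_nhds.1 hy0 (σ i)
  have h4 := hx0.dist h3
  rw [dist_self] at h4
  obtain ⟨m, hm⟩ := (h4.eventually (gt_mem_nhds hη)).exists
  exact absurd hm (not_lt.2 (hxy (φ m) _ (by rw [rootPoly_comp_perm, hy])).le)

/-- A chain of points with small steps that stays near `n` points has small displacement. -/
theorem dist_le_of_chain {α : Type*} [PseudoMetricSpace α] {x : ℕ → α} {a : Fin n → α} {η : ℝ}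
    (hη : 0 ≤ η) {k l : ℕ} (hkl : k ≤ l)
    (hstep : ∀ i, k ≤ i → i < l → dist (x i) (x (i + 1)) ≤ η)
    (hnear : ∀ i, k ≤ i → i ≤ l → ∃ j, dist (x i) (a j) ≤ η) :
    dist (x k) (x l) ≤ (3 * n + 2) * η := by
  -- Centres of consecutive points are at distance at most `η + η + η`, so the chain traces a walk
  -- in this graph.
  let G : SimpleGraph (Fin n) := SimpleGraph.fromRel fun i j => dist (a i) (a j) ≤ 3 * η
  have hadj : ∀ i j, G.Adj i j → dist (a i) (a j) ≤ 3 * η := by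
    intro i j h
    rcases ((SimpleGraph.fromRel_adj _ _ _).1 h).2 with h | h
    · exact h
    · rwa [dist_comm]
  have hwalk : ∀ (i j : Fin n) (w : G.Walk i j), dist (a i) (a j) ≤ w.length * (3 * η) := by
    intro i j w
    induction w with
    | nil => simp
    | cons h w ih =>
      refine (dist_triangle _ _ _).trans ((add_le_add (hadj _ _ h) ih).trans_eq ?_)
      rw [SimpleGraph.Walk.length_cons]; push_cast; ring
  obtain ⟨j₀, hj₀⟩ := hnear k le_rfl hkl
  have hreach : ∀ m, k ≤ m → m ≤ l → ∃ j, dist (x m) (a j) ≤ η ∧ G.Reachable j₀ j := by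
    intro m hm
    induction m, hm using Nat.le_induction with
    | base => exact fun _ => ⟨j₀, hj₀, .rfl⟩
    | succ m hm ih =>
      intro hml
      obtain ⟨j, hj, hr⟩ := ih (by omega)
      obtain ⟨j', hj'⟩ := hnear (m + 1) (by omega) hml
      refine ⟨j', hj', hr.trans ?_⟩
      by_cases hjj : j = j'
      · rw [hjj]
      · refine SimpleGraph.Adj.reachable ((SimpleGraph.fromRel_adj _ _ _).2 ⟨hjj, Or.inl ?_⟩)
        have h1 := hstep m hm (by omega)
        have h2 := dist_triangle4 (a j) (x m) (x (m + 1)) (a j')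
        rw [dist_comm (a j) (x m)] at h2
        linarith
  obtain ⟨j, hj, ⟨w⟩⟩ := hreach l hkl le_rfl
  classical
  -- Removing the loops leaves a path on at most `n` vertices, so the bound does not depend on the
  -- number of steps of the chain.
  have hlen : ((w.bypass.length : ℕ) : ℝ) ≤ n := by
    have := (w.bypass_isPath).length_lt
    rw [Fintype.card_fin] at this
    exact_mod_cast this.le
  have h1 := hwalk _ _ w.bypass
  have h2 := dist_triangle4 (x k) (a j₀) (a j) (x l)
  rw [dist_comm (a j)] at h2
  nlinarith

theorem exists_chain {q : ℝ → ℂ[X]} (hex : ∀ t, ∃ x : Fin n → ℂ, rootPoly x = q t) {δ η h : ℝ}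
    (hh : 0 < h) (hhδ : h < δ)
    (hmatch : ∀ s t, |s - t| < δ → ∀ x : Fin n → ℂ, rootPoly x = q s →
      ∃ y : Fin n → ℂ, rootPoly y = q t ∧ dist x y ≤ η) :
    ∃ x : ℕ → Fin n → ℂ, ∀ k : ℕ, rootPoly (x k) = q (k * h) ∧ dist (x k) (x (k + 1)) ≤ η := by
  have h1 : ∀ (k : ℕ) (x : {x : Fin n → ℂ // rootPoly x = q (k * h)}),
      ∃ y : {x : Fin n → ℂ // rootPoly x = q ((k + 1 : ℕ) * h)}, dist x.1 y.1 ≤ η := by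
    intro k x
    obtain ⟨y, hy, hxy⟩ := hmatch (k * h) ((k + 1 : ℕ) * h) (by
      rw [abs_sub_comm, abs_of_pos] <;> push_cast <;> linarith) x.1 x.2
    exact ⟨⟨y, hy⟩, hxy⟩
  choose nxt hnxt using h1
  obtain ⟨x₀, hx₀⟩ := hex ((0 : ℕ) * h)
  let X : ∀ k : ℕ, {x : Fin n → ℂ // rootPoly x = q (k * h)} := fun k => Nat.rec ⟨x₀, hx₀⟩ nxt k
  exact ⟨fun k => (X k).1, fun k => ⟨(X k).2, hnxt k (X k)⟩⟩

/-- On grids of mesh tending to `0` the roots are followed from node to node by matching, and a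
limit is taken along an ultrafilter. Equicontinuity comes from `dist_le_of_chain`: on a short
interval each followed root makes small steps and stays near the `n` roots at the left end, so its
displacement is small however many steps there are. -/
theorem exists_continuousOn_roots_of_matching {q : ℝ → ℂ[X]}
    (hq : ∀ z, Continuous fun t => (q t).eval z) {B : ℝ}
    (hB : ∀ t, ∀ x : Fin n → ℂ, rootPoly x = q t → ‖x‖ ≤ B)
    (hex : ∀ t, ∃ x : Fin n → ℂ, rootPoly x = q t)
    (hmatch : ∀ η > 0, ∃ δ > 0, ∀ s t, |s - t| < δ → ∀ x : Fin n → ℂ, rootPoly x = q s →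
      ∃ y : Fin n → ℂ, rootPoly y = q t ∧ dist x y ≤ η) :
    ∃ f : ℝ → Fin n → ℂ, ContinuousOn f (Set.Ici 0) ∧ ∀ t, 0 ≤ t → rootPoly (f t) = q t := by
  choose! δ hδ hmat using hmatch
  let η : ℕ → ℝ := fun m => 1 / ((m : ℝ) + 1)
  have hη : ∀ m, 0 < η m := fun m => by positivity
  have hη0 : Tendsto η atTop (𝓝 0) := tendsto_one_div_add_atTop_nhds_zero_nat
  -- The mesh is below `δ (η m)`, so that adjacent nodes match within `η m`, and below `η m`, so
  -- that it tends to `0`.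
  let h : ℕ → ℝ := fun m => min (δ (η m)) (η m) / 2
  have hh : ∀ m, 0 < h m := fun m => half_pos (lt_min (hδ _ (hη m)) (hη m))
  have hhδ : ∀ m, h m < δ (η m) := fun m =>
    (half_lt_self (lt_min (hδ _ (hη m)) (hη m))).trans_le (min_le_left _ _)
  have hhη : ∀ m, h m ≤ η m := fun m =>
    (half_lt_self (lt_min (hδ _ (hη m)) (hη m))).le.trans (min_le_right _ _)
  have hh0 : Tendsto h atTop (𝓝 0) := squeeze_zero (fun m => (hh m).le) hhη hη0
  choose x hx using fun m => exists_chain hex (hh m) (hhδ m) (hmat (η m) (hη m))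
  let U : Ultrafilter ℕ := hyperfilter ℕ
  have hU : (U : Filter ℕ) ≤ atTop := Nat.hyperfilter_le_atTop
  have hlim : ∀ t : ℝ, ∃ l, Tendsto (fun m => x m ⌊t / h m⌋₊) U (𝓝 l) := by
    intro t
    have hc := isCompact_closedBall (0 : Fin n → ℂ) B
    obtain ⟨l, -, hl⟩ := hc.ultrafilter_le_nhds (U.map fun m => x m ⌊t / h m⌋₊) (by
      rw [le_principal_iff]
      exact Filter.mem_map.2 (univ_mem' fun m => by simpa using hB _ _ ((hx m _).1)))
    exact ⟨l, hl⟩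
  choose f hf using hlim
  have hnode : ∀ t, 0 ≤ t → ∀ m, (⌊t / h m⌋₊ : ℝ) * h m ≤ t ∧ t < (⌊t / h m⌋₊ : ℝ) * h m + h m := by
    intro t ht m
    have h1 := Nat.floor_le (div_nonneg ht (hh m).le)
    have h2 := Nat.lt_floor_add_one (t / h m)
    rw [le_div_iff₀ (hh m)] at h1
    rw [div_lt_iff₀ (hh m)] at h2
    exact ⟨h1, by linarith⟩
  have hroot : ∀ t, 0 ≤ t → rootPoly (f t) = q t := by
    intro t ht
    refine rootPoly_eq_of_tendsto (l := (U : Filter ℕ)) hq (hf t)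
      (s := fun m => (⌊t / h m⌋₊ : ℝ) * h m) ?_ fun m => (hx m _).1
    refine Tendsto.mono_left ?_ hU
    refine tendsto_of_tendsto_of_tendsto_of_le_of_le (g := fun m => t - h m) (h := fun _ => t)
      (by simpa using tendsto_const_nhds.sub hh0) tendsto_const_nhds ?_ ?_
    · intro m
      have := (hnode t ht m).2
      dsimp only; linarith
    · exact fun m => (hnode t ht m).1
  refine ⟨f, ?_, hroot⟩
  have key : ∀ e > 0, ∀ s t, 0 ≤ s → s ≤ t → t - s < δ e / 2 →
      dist (f s) (f t) ≤ (3 * n + 2) * e := by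
    intro e he s t hs hst hd
    refine le_of_tendsto ((hf s).dist (hf t)) (hU ?_)
    filter_upwards [hη0.eventually (gt_mem_nhds he),
      hh0.eventually (gt_mem_nhds (half_pos (hδ e he)))] with m hm1 hm2
    refine (dist_pi_le_iff (by positivity)).2 fun i => ?_
    have hs' := hnode s hs m
    have ht' := hnode t (hs.trans hst) m
    refine dist_le_of_chain (a := f s) (x := fun k => x m k i) he.le
      (Nat.floor_le_floor (div_le_div_of_nonneg_right hst (hh m).le)) ?_ ?_
    · intro k _ _
      exact (dist_le_pi_dist _ _ i).trans ((hx m k).2.trans hm1.le)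
    · intro k hk1 hk2
      have h1 : (⌊s / h m⌋₊ : ℝ) * h m ≤ k * h m :=
        mul_le_mul_of_nonneg_right (by exact_mod_cast hk1) (hh m).le
      have h2 : k * h m ≤ (⌊t / h m⌋₊ : ℝ) * h m :=
        mul_le_mul_of_nonneg_right (by exact_mod_cast hk2) (hh m).le
      obtain ⟨y, hy, hxy⟩ := hmat e he (k * h m) s (by rw [abs_lt]; constructor <;> linarith)
        (x m k) (hx m k).1
      obtain ⟨σ, rfl⟩ := exists_perm_of_rootPoly_eq (hy.trans (hroot s hs).symm)
      exact ⟨σ i, (dist_le_pi_dist _ _ i).trans hxy⟩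
  rw [Metric.continuousOn_iff]
  intro s hs e he
  have he' : 0 < e / (3 * n + 3) := by positivity
  refine ⟨δ (e / (3 * n + 3)) / 2, half_pos (hδ _ he'), fun t ht hts => ?_⟩
  have hlt : (3 * n + 2) * (e / (3 * n + 3)) < e := by
    rw [mul_div_assoc', div_lt_iff₀ (by positivity)]; nlinarith
  rw [Real.dist_eq, abs_lt] at hts
  rcases le_total s t with hle | hle
  · rw [dist_comm]
    exact (key _ he' s t hs hle (by linarith)).trans_lt hlt
  · exact (key _ he' t s ht hle (by linarith)).trans_lt hlt

theorem norm_le_of_rootPoly_eq {q : ℂ[X]} {x : Fin n → ℂ} (h : rootPoly x = q) {A : ℝ}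
    (hA : 0 ≤ A) (hq : ∀ j < n, ‖q.coeff j‖ ≤ A) : ‖x‖ ≤ A + 1 := by
  refine (pi_norm_le_iff_of_nonneg (by positivity)).2 fun i => ?_
  have hr : IsRoot q (x i) := by
    rw [← h, IsRoot.def, rootPoly_eval]
    exact Finset.prod_eq_zero (Finset.mem_univ i) (sub_self _)
  have h1 := hr.norm_lt_cauchyBound (h ▸ (rootPoly_monic x).ne_zero)
  lift A to NNReal using hA
  have h2 : cauchyBound q ≤ A + 1 := by
    have h4 : q.leadingCoeff = 1 := h ▸ rootPoly_monic x
    have h5 : q.natDegree = n := h ▸ rootPoly_natDegree x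
    unfold cauchyBound
    rw [h4, h5, nnnorm_one, div_one]
    gcongr
    exact Finset.sup_le fun j hj => hq j (Finset.mem_range.1 hj)
  exact_mod_cast h1.le.trans h2

/-- The roots of a monic polynomial whose coefficients depend continuously on a parameter in a
compact interval can be chosen continuously. -/
theorem exists_continuousOn_roots {a : ℝ} (ha : 0 ≤ a) {q : ℝ → ℂ[X]}
    (hmonic : ∀ t ∈ Set.Icc 0 a, (q t).Monic) (hdeg : ∀ t ∈ Set.Icc 0 a, (q t).natDegree = n)
    (hq : ∀ j, ContinuousOn (fun t => (q t).coeff j) (Set.Icc 0 a)) :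
    ∃ f : ℝ → Fin n → ℂ, ContinuousOn f (Set.Icc 0 a) ∧
      ∀ t ∈ Set.Icc 0 a, rootPoly (f t) = q t := by
  -- Composing with the `1`-Lipschitz projection onto the interval extends the family to all of `ℝ`
  -- and keeps the matching uniform.
  let π : ℝ → ℝ := fun t => Set.projIcc 0 a ha t
  have hπ : ∀ t, π t ∈ Set.Icc 0 a := fun t => (Set.projIcc 0 a ha t).2
  have hπc : Continuous π := continuous_subtype_val.comp continuous_projIcc
  have hπd : ∀ s t, |π s - π t| ≤ |s - t| := fun s t => by
    simpa [Real.dist_eq] using Set.abs_projIcc_sub_projIcc (h := ha) (c := s) (d := t)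
  have hπe : ∀ t ∈ Set.Icc 0 a, π t = t := fun t ht => by
    simp only [π, Set.projIcc_of_mem ha ht]
  have hcc : ∀ j, Continuous fun t => (q (π t)).coeff j := fun j =>
    (hq j).comp_continuous hπc hπ
  have hev : ∀ z, Continuous fun t => (q (π t)).eval z := by
    intro z
    have : (fun t => (q (π t)).eval z) =
        fun t => ∑ j ∈ Finset.range (n + 1), (q (π t)).coeff j * z ^ j := by
      funext t
      rw [eval_eq_sum_range, hdeg _ (hπ t)]
    rw [this]
    exact continuous_finsetSum _ fun j _ => (hcc j).mul continuous_const
  have hbd : ∃ A : ℝ, 0 ≤ A ∧ ∀ t ∈ Set.Icc 0 a, ∀ j < n, ‖(q t).coeff j‖ ≤ A := by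
    choose A hA using fun j => isCompact_Icc.exists_bound_of_continuousOn (hq j)
    refine ⟨∑ j ∈ Finset.range n, |A j|, Finset.sum_nonneg fun _ _ => abs_nonneg _, ?_⟩
    intro t ht j hj
    exact ((hA j t ht).trans (le_abs_self _)).trans
      (Finset.single_le_sum (f := fun j => |A j|) (fun _ _ => abs_nonneg _)
        (Finset.mem_range.2 hj))
  obtain ⟨A, hA, hbd⟩ := hbd
  have hB : ∀ t, ∀ x : Fin n → ℂ, rootPoly x = q (π t) → ‖x‖ ≤ A + 1 := fun t x hx =>
    norm_le_of_rootPoly_eq hx hA (hbd _ (hπ t))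
  have hex : ∀ t, ∃ x : Fin n → ℂ, rootPoly x = q (π t) := fun t =>
    exists_rootPoly_eq (hmonic _ (hπ t)) (hdeg _ (hπ t))
  obtain ⟨f, hf, hfr⟩ := exists_continuousOn_roots_of_matching hev hB hex (by
    intro η hη
    obtain ⟨δ, hδ, h⟩ := exists_matching hev (isCompact_Icc (a := 0) (b := a))
      (fun t _ => hB t) (fun t _ => hex t) hη
    refine ⟨δ, hδ, fun s t hst x hx => ?_⟩
    obtain ⟨y, hy, hxy⟩ := h (π s) (hπ s) (π t) (hπ t) ((hπd s t).trans_lt hst) x (by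
      rw [hx, hπe _ (hπ s)])
    exact ⟨y, by rw [hy, hπe _ (hπ t)], hxy⟩)
  exact ⟨f, hf.mono fun t ht => ht.1, fun t ht => by rw [hfr t ht.1, hπe t ht]⟩

/-! ### The complex polynomials attached to a polynomial over germs -/

theorem natDegree_eq_of_lead {Q : ModGerm[X]} (hdeg : Q.natDegree ≤ n) (hlead : Q.coeff n = 1) :
    Q.natDegree = n :=
  natDegree_eq_of_le_of_coeff_ne_zero hdeg (hlead ▸ one_ne_zero)

theorem coeff_evalAt {Q : ModGerm[X]} (hdeg : Q.natDegree = n) (ε : ℝ) {j : ℕ} (hj : j ≤ n) :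
    (evalAt Q ε).coeff j = germVal (Q.coeff j) ε := by
  rw [evalAt, finsetSum_coeff]
  simp only [coeff_monomial, Finset.sum_ite_eq', Finset.mem_range]
  rw [if_pos (by omega)]

theorem natDegree_evalAt_le {Q : ModGerm[X]} (hdeg : Q.natDegree = n) (ε : ℝ) :
    (evalAt Q ε).natDegree ≤ n := by
  rw [evalAt]
  refine natDegree_sum_le_of_forall_le _ _ fun j hj => (natDegree_monomial_le _).trans ?_
  have := Finset.mem_range.1 hj
  omega

theorem eval_evalAt {Q : ModGerm[X]} (hdeg : Q.natDegree = n) (ε : ℝ) (z : ℂ) :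
    (evalAt Q ε).eval z = ∑ j ∈ Finset.range (n + 1), germVal (Q.coeff j) ε * z ^ j := by
  rw [evalAt, eval_finsetSum, hdeg]
  simp

theorem germVal_one : ∀ᶠ ε in 𝓝[>] (0 : ℝ), germVal 1 ε = 1 :=
  germVal_eventuallyEq 1 1 rfl

theorem evalAt_monic {Q : ModGerm[X]} (hdeg : Q.natDegree = n) (hlead : Q.coeff n = 1) :
    ∀ᶠ ε in 𝓝[>] (0 : ℝ), (evalAt Q ε).Monic ∧ (evalAt Q ε).natDegree = n := by
  filter_upwards [germVal_one] with ε hε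
  have h1 : (evalAt Q ε).coeff n = 1 := by rw [coeff_evalAt hdeg ε le_rfl, hlead, hε]
  have h2 := natDegree_eq_of_le_of_coeff_ne_zero (natDegree_evalAt_le hdeg ε)
    (h1 ▸ one_ne_zero)
  exact ⟨by rw [Monic, leadingCoeff, h2, h1], h2⟩

theorem roots_evalAt_iff {Q : ModGerm[X]} (hdeg : Q.natDegree = n) (hlead : Q.coeff n = 1)
    (x : ℝ → Fin n → ℂ) :
    (∀ᶠ ε in 𝓝[>] (0 : ℝ), (evalAt Q ε).roots = Finset.univ.val.map (x ε)) ↔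
      ∀ᶠ ε in 𝓝[>] (0 : ℝ), evalAt Q ε = rootPoly (x ε) := by
  refine eventually_congr ?_
  filter_upwards [evalAt_monic hdeg hlead] with ε hε
  constructor
  · intro h
    rw [← prod_multiset_X_sub_C_of_monic_of_roots_card_eq hε.1 (by rw [h, hε.2]; simp), h,
      Multiset.map_map]
    rfl
  · intro h
    rw [h, rootPoly_roots]

/-! ### Continuous choice of the roots -/

/-- A power exceeding the growth exponent by at least `1` makes the product `O(ε)`, hence continuous
at `0`, where the factor `0 ^ N` already gives the value `0`. -/
theorem continuousOn_pow_mul {g : ℝ → ℂ} {a k : ℝ} {N : ℕ} (hk : k + 1 ≤ N) (hN : N ≠ 0)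
    (hg : ContinuousOn g (Set.Ioo 0 a)) (hgk : ∀ ε ∈ Set.Ioo 0 a, ‖g ε‖ ≤ ε ^ (-k)) {b : ℝ}
    (hba : b < a) (hb1 : b ≤ 1) :
    ContinuousOn (fun ε : ℝ => (ε : ℂ) ^ N * g ε) (Set.Icc 0 b) ∧
      ∀ ε ∈ Set.Icc 0 b, ‖(ε : ℂ) ^ N * g ε‖ ≤ ε := by
  have hbd : ∀ ε ∈ Set.Icc 0 b, ‖(ε : ℂ) ^ N * g ε‖ ≤ ε := by
    intro ε hε
    rcases hε.1.eq_or_lt with h0 | h0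
    · rw [← h0]; simp [hN]
    · rw [norm_mul, norm_pow, Complex.norm_real, Real.norm_of_nonneg hε.1]
      calc ε ^ N * ‖g ε‖ ≤ ε ^ N * ε ^ (-k) :=
            mul_le_mul_of_nonneg_left (hgk ε ⟨h0, hε.2.trans_lt hba⟩) (by positivity)
        _ = ε ^ ((N : ℝ) + -k) := by rw [Real.rpow_add h0, Real.rpow_natCast]
        _ ≤ ε ^ (1 : ℝ) := Real.rpow_le_rpow_of_exponent_ge h0 (hε.2.trans hb1) (by linarith)
        _ = ε := Real.rpow_one ε
  refine ⟨fun ε hε => ?_, hbd⟩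
  rcases hε.1.eq_or_lt with h0 | h0
  · subst h0
    rw [ContinuousWithinAt, Complex.ofReal_zero, zero_pow hN, zero_mul]
    refine squeeze_zero_norm' (eventually_nhdsWithin_of_forall hbd) ?_
    exact tendsto_nhdsWithin_of_tendsto_nhds tendsto_id
  · have h1 : ContinuousAt g ε := hg.continuousAt (Ioo_mem_nhds h0 (hε.2.trans_lt hba))
    exact ((Complex.continuous_ofReal.pow N).continuousAt.mul h1).continuousWithinAt

theorem exists_common_bounds (Q : ModGerm[X]) (n : ℕ) : ∃ (g : ℕ → ℝ → ℂ) (a : ℝ) (K : ℕ),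
    0 < a ∧ ∀ j < n, ContinuousOn (g j) (Set.Ioo 0 a) ∧
      (∀ ε ∈ Set.Ioo 0 a, ‖g j ε‖ ≤ ε ^ (-(K : ℝ))) ∧ germVal (Q.coeff j) =ᶠ[𝓝[>] 0] g j := by
  choose g a k ha hk hg hgk hgQ using fun j => (Q.coeff j).2
  have h1 : ∀ᶠ b in 𝓝[>] (0 : ℝ), ∀ j ∈ Finset.range n, b ≤ a j :=
    (eventually_all_finset _).2 fun j _ =>
      (eventually_le_nhds (ha j)).filter_mono nhdsWithin_le_nhds
  have h2 : ∀ᶠ K : ℕ in atTop, ∀ j ∈ Finset.range n, k j ≤ (K : ℝ) :=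
    (eventually_all_finset _).2 fun j _ =>
      tendsto_natCast_atTop_atTop.eventually (eventually_ge_atTop (k j))
  obtain ⟨b, ⟨hb, hb1⟩, hb0⟩ := ((h1.and ((eventually_le_nhds one_pos).filter_mono
    nhdsWithin_le_nhds)).and self_mem_nhdsWithin).exists
  obtain ⟨K, hK⟩ := h2.exists
  refine ⟨g, b, K, hb0, fun j hj => ⟨?_, ?_, ?_⟩⟩
  · exact (hg j).mono (Set.Ioo_subset_Ioo_right (hb j (Finset.mem_range.2 hj)))
  · intro ε hε
    refine (hgk j ε ⟨hε.1, hε.2.trans_le (hb j (Finset.mem_range.2 hj))⟩).trans ?_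
    exact Real.rpow_le_rpow_of_exponent_ge hε.1 (hε.2.le.trans hb1)
      (neg_le_neg (hK j (Finset.mem_range.2 hj)))
  · exact germVal_eventuallyEq _ _ (hgQ j)

theorem exists_modGerm {g : ℝ → ℂ} {a k : ℝ} (ha : 0 < a) (hk : 0 < k)
    (hg : ContinuousOn g (Set.Ioo 0 a)) (hgk : ∀ ε ∈ Set.Ioo 0 a, ‖g ε‖ ≤ ε ^ (-k)) :
    ∃ f : ModGerm, germVal f =ᶠ[𝓝[>] 0] g :=
  ⟨⟨(g : Germ (𝓝[>] (0 : ℝ)) ℂ), g, a, k, ha, hk, hg, hgk, rfl⟩, germVal_eventuallyEq _ _ rfl⟩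

/-- The roots of a monic polynomial over germs can be chosen as germs. -/
theorem exists_root_germs {Q : ModGerm[X]} (hdeg : Q.natDegree = n) (hlead : Q.coeff n = 1) :
    ∃ rt : Fin n → ModGerm,
      ∀ᶠ ε in 𝓝[>] (0 : ℝ), evalAt Q ε = rootPoly (fun j => germVal (rt j) ε) := by
  obtain ⟨g, a, K, ha, hg⟩ := exists_common_bounds Q n
  set L := K + 1 with hL
  set b : ℝ := min (a / 2) (1 / 2) with hb
  have hb0 : 0 < b := by positivity
  have hba : b < a := (min_le_left _ _).trans_lt (half_lt_self ha)
  have hb1 : b ≤ 1 / 2 := min_le_right _ _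
  have hc : ∀ j < n, ContinuousOn (fun ε : ℝ => (ε : ℂ) ^ (L * (n - j)) * g j ε) (Set.Icc 0 b) ∧
      ∀ ε ∈ Set.Icc 0 b, ‖(ε : ℂ) ^ (L * (n - j)) * g j ε‖ ≤ ε := by
    intro j hj
    have h0 : L ≤ L * (n - j) := Nat.le_mul_of_pos_right _ (by omega)
    refine continuousOn_pow_mul (k := K) ?_ (by omega) (hg j hj).1 (hg j hj).2.1 hba (by linarith)
    exact_mod_cast h0
  -- This is the monic polynomial whose roots are `ε ^ L` times those of `Q`; the weight `L (n - j)`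
  -- comes from homogeneity. Its coefficients are continuous on `[0, b]`.
  let q : ℝ → ℂ[X] := fun ε : ℝ =>
    X ^ n + ∑ j ∈ Finset.range n, monomial j (((ε : ℝ) : ℂ) ^ (L * (n - j)) * g j ε)
  have hqd : ∀ ε : ℝ, (∑ j ∈ Finset.range n, monomial j ((ε : ℂ) ^ (L * (n - j)) * g j ε)).degree
      < (n : ℕ) := by
    intro ε
    refine (degree_sum_le _ _).trans_lt ((Finset.sup_lt_iff (WithBot.bot_lt_coe _)).2 ?_)
    intro j hj
    exact (degree_monomial_le _ _).trans_lt (by exact_mod_cast Finset.mem_range.1 hj)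
  have hqm : ∀ ε, (q ε).Monic := fun ε => monic_X_pow_add (hqd ε)
  have hqn : ∀ ε, (q ε).natDegree = n := fun ε => by
    refine natDegree_eq_of_degree_eq_some ?_
    rw [degree_add_eq_left_of_degree_lt] <;> rw [degree_X_pow]
    exact hqd ε
  have hqc : ∀ (ε : ℝ) (j : ℕ), (q ε).coeff j =
      (if j = n then 1 else 0) + if j < n then (ε : ℂ) ^ (L * (n - j)) * g j ε else 0 := by
    intro ε j
    simp only [q, coeff_add, coeff_X_pow, finsetSum_coeff, coeff_monomial, Finset.sum_ite_eq',
      Finset.mem_range]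
  obtain ⟨f, hf, hfq⟩ := exists_continuousOn_roots (a := b) hb0.le (q := q)
    (fun t _ => hqm t) (fun t _ => hqn t) (by
      intro j
      simp only [hqc]
      refine continuousOn_const.add ?_
      split_ifs with hj
      · exact (hc j hj).1
      · exact continuousOn_const)
  have hfb : ∀ ε ∈ Set.Icc 0 b, ‖f ε‖ ≤ 2 := by
    intro ε hε
    refine (norm_le_of_rootPoly_eq (hfq ε hε) zero_le_one fun j hj => ?_).trans_eq one_add_one_eq_two
    rw [hqc, if_neg hj.ne, if_pos hj, zero_add]
    linarith [(hc j hj).2 ε hε, hε.2]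
  have hrt : ∀ i, ∃ r : ModGerm, germVal r =ᶠ[𝓝[>] 0] fun ε : ℝ => ((ε : ℂ) ^ L)⁻¹ * f ε i := by
    intro i
    refine exists_modGerm (a := b) (k := L + 1) hb0 (by positivity) ?_ ?_
    · refine ContinuousOn.mul ?_ ?_
      · refine (Complex.continuous_ofReal.pow L).continuousOn.inv₀ fun ε hε => ?_
        exact pow_ne_zero _ (Complex.ofReal_ne_zero.2 hε.1.ne')
      · exact (continuousOn_pi.1 hf i).mono Set.Ioo_subset_Icc_self
    · intro ε hε
      have h1 : ‖f ε i‖ ≤ 2 := (norm_le_pi_norm _ i).trans (hfb ε ⟨hε.1.le, hε.2.le⟩)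
      -- The bound `2` on the rescaled roots is absorbed in one more power of `ε⁻¹`, whence the
      -- growth exponent `L + 1`.
      have h2 : 2 ≤ ε⁻¹ := by
        rw [le_inv_comm₀ two_pos hε.1]; linarith [hε.2]
      rw [norm_mul, norm_inv, norm_pow, Complex.norm_real, Real.norm_of_nonneg hε.1.le,
        Real.rpow_neg hε.1.le, Real.rpow_add hε.1, Real.rpow_one, Real.rpow_natCast, mul_inv]
      exact mul_le_mul_of_nonneg_left (h1.trans h2) (inv_nonneg.2 (pow_nonneg hε.1.le _))
  choose rt hrt using hrt
  refine ⟨rt, ?_⟩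
  have hgj : ∀ᶠ ε in 𝓝[>] (0 : ℝ), ∀ j ∈ Finset.range n, germVal (Q.coeff j) ε = g j ε :=
    (eventually_all_finset _).2 fun j hj => (hg j (Finset.mem_range.1 hj)).2.2
  filter_upwards [hgj, eventually_all.2 hrt, germVal_one, Ioo_mem_nhdsGT hb0]
    with ε h1 h2 h3 h4
  refine Polynomial.funext fun z => ?_
  have hε : ((ε : ℂ) ^ L) ≠ 0 := pow_ne_zero _ (Complex.ofReal_ne_zero.2 h4.1.ne')
  have h5 : ((ε : ℂ) ^ L) ^ n * (rootPoly (fun j => germVal (rt j) ε)).eval z =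
      (q ε).eval ((ε : ℂ) ^ L * z) := by
    rw [← hfq ε ⟨h4.1.le, h4.2.le⟩, rootPoly_eval, rootPoly_eval]
    have : ((ε : ℂ) ^ L) ^ n = ∏ _i : Fin n, ((ε : ℂ) ^ L) := by simp
    rw [this, ← Finset.prod_mul_distrib]
    refine Finset.prod_congr rfl fun i _ => ?_
    rw [h2 i, mul_sub, mul_inv_cancel_left₀ hε]
  refine mul_left_cancel₀ (pow_ne_zero n hε) ?_
  rw [h5, eval_evalAt hdeg, Finset.sum_range_succ, hlead, h3, one_mul, mul_add, add_comm]
  simp only [q, eval_add, eval_pow, eval_X, eval_finsetSum, eval_monomial]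
  rw [mul_pow, Finset.mul_sum]
  congr 1
  refine Finset.sum_congr rfl fun j hj => ?_
  have hjn := Finset.mem_range.1 hj
  rw [h1 j hj, mul_pow, ← pow_mul, ← pow_mul]
  have : L * n = L * (n - j) + L * j := by rw [← mul_add, Nat.sub_add_cancel hjn.le]
  rw [this, pow_add]
  ring

/-! ### Limits of rescaled polynomials -/

theorem coeff_saturated (p : ℂ[X]) (P : Rmin[X]) (C : Rmin) {j : ℕ} (hj : j ≤ n) :
    (saturated n p P C).coeff j =
      open Classical in if P.eval C = P.coeff j * C ^ j then p.coeff j else 0 := by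
  classical
  rw [saturated, finsetSum_coeff]
  simp only [coeff_monomial, Finset.sum_ite_eq', Finset.mem_filter, Finset.mem_range]
  simp [hj]

theorem natDegree_saturated_le (p : ℂ[X]) (P : Rmin[X]) (C : Rmin) :
    (saturated n p P C).natDegree ≤ n := by
  classical
  rw [saturated]
  refine natDegree_sum_le_of_forall_le _ _ fun j hj => (natDegree_monomial_le _).trans ?_
  have := Finset.mem_range.1 (Finset.mem_filter.1 hj).1
  omega

theorem eval_saturated (p : ℂ[X]) (P : Rmin[X]) (C : Rmin) (z : ℂ) :
    (saturated n p P C).eval z =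
      ∑ j ∈ Finset.range (n + 1), (saturated n p P C).coeff j * z ^ j :=
  eval_eq_sum_range' (Nat.lt_succ_of_le (natDegree_saturated_le p P C)) z

theorem tendsto_rpow_zero {s : ℝ} (hs : 0 < s) :
    Tendsto (fun ε : ℝ => ((ε ^ s : ℝ) : ℂ)) (𝓝[>] 0) (𝓝 0) := by
  have h := (Real.continuousAt_rpow_const 0 s (Or.inr hs.le)).tendsto
  rw [Real.zero_rpow hs.ne'] at h
  rw [← Complex.ofReal_zero]
  exact (Complex.continuous_ofReal.tendsto 0).comp (h.mono_left nhdsWithin_le_nhds)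

theorem eventually_pos : ∀ᶠ ε in 𝓝[>] (0 : ℝ), 0 < ε := self_mem_nhdsWithin

namespace CoeffsWithEquivalents

variable {Q : ModGerm[X]} {p : ℂ[X]} {P : Rmin[X]} {c : Fin n → Rmin}

/-- The rescaled coefficient has exponent `Pⱼ + j v - rootSum c v ≥ 0`, which is zero exactly for
the terms attaining the minimum; the others tend to `0`. -/
theorem tendsto_coeff (h : CoeffsWithEquivalents Q p P c) (v : ℝ) {j : ℕ} (hj : j ≤ n) :
    Tendsto (fun ε : ℝ => ((ε ^ (j * v - rootSum c v) : ℝ) : ℂ) * germVal (Q.coeff j) ε)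
      (𝓝[>] 0) (𝓝 ((saturated n p P (ofReal v)).coeff j)) := by
  classical
  rw [coeff_saturated p P _ hj, h.roots.eval_ofReal h.lead']
  rcases h.equivalent j hj with ⟨h1, h2⟩ | ⟨a, h1, h2⟩
  · rw [h1, zero_mul, if_neg (ofReal_ne_zero _)]
    refine tendsto_const_nhds.congr' ?_
    filter_upwards [(eq_zero_iff _).1 h2] with ε hε
    rw [hε, mul_zero]
  · rw [h1, ← ofReal_natCast_mul, ← ofReal_add]
    have h3 := h.roots.rootSum_le h.lead' h1 v
    have h4 : (fun ε : ℝ => ((ε ^ (j * v - rootSum c v) : ℝ) : ℂ) * germVal (Q.coeff j) ε)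
        =ᶠ[𝓝[>] 0] fun ε : ℝ => ((ε ^ (a + j * v - rootSum c v) : ℝ) : ℂ) *
          (((ε ^ (-a) : ℝ) : ℂ) * germVal (Q.coeff j) ε) := by
      filter_upwards [eventually_pos] with ε hε
      rw [← mul_assoc, ← Complex.ofReal_mul, ← Real.rpow_add hε]
      congr 3; ring
    refine Tendsto.congr' h4.symm ?_
    have h7 : (ofReal (rootSum c v) = ofReal (a + j * v)) ↔ rootSum c v = a + j * v := ofReal_inj
    split_ifs with h5 <;> rw [h7] at h5
    · rw [← h5]
      simpa using h2
    · have h6 := (tendsto_rpow_zero (sub_pos.2 (lt_of_le_of_ne h3 h5))).mul h2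
      rwa [zero_mul] at h6

theorem saturated_ne_zero (h : CoeffsWithEquivalents Q p P c) (v : ℝ) :
    saturated n p P (ofReal v) ≠ 0 := by
  intro h0
  obtain ⟨h1, h2⟩ := h.vertex_right v
  have h3 := coeff_saturated p P (ofReal v) (countGT_le c v)
  rw [h0, coeff_zero, h.roots.eval_ofReal h.lead', h2, ← ofReal_natCast_mul, ← ofReal_add,
    sub_add_cancel, if_pos rfl] at h3
  exact h1 h3.symm

/-- The point `z ε` may move as long as it stays bounded, so that a branch of roots can be inserted.
-/
theorem tendsto_eval_sub (h : CoeffsWithEquivalents Q p P c) (hdeg : Q.natDegree = n) (v : ℝ)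
    {z : ℝ → ℂ} {M : ℝ} (hz : ∀ᶠ ε in 𝓝[>] (0 : ℝ), ‖z ε‖ ≤ M) :
    Tendsto (fun ε : ℝ => ((ε ^ (-rootSum c v) : ℝ) : ℂ) *
        (evalAt Q ε).eval (((ε ^ v : ℝ) : ℂ) * z ε) - (saturated n p P (ofReal v)).eval (z ε))
      (𝓝[>] 0) (𝓝 0) := by
  have h1 : (fun ε : ℝ => ((ε ^ (-rootSum c v) : ℝ) : ℂ) *
        (evalAt Q ε).eval (((ε ^ v : ℝ) : ℂ) * z ε) - (saturated n p P (ofReal v)).eval (z ε))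
      =ᶠ[𝓝[>] 0] fun ε : ℝ => ∑ j ∈ Finset.range (n + 1),
        (((ε ^ (j * v - rootSum c v) : ℝ) : ℂ) * germVal (Q.coeff j) ε -
          (saturated n p P (ofReal v)).coeff j) * z ε ^ j := by
    filter_upwards [eventually_pos] with ε hε
    rw [eval_evalAt hdeg, eval_saturated, Finset.mul_sum, ← Finset.sum_sub_distrib]
    refine Finset.sum_congr rfl fun j _ => ?_
    rw [sub_eq_add_neg (j * v), Real.rpow_add hε, mul_pow, mul_comm (j : ℝ) v, Real.rpow_mul hε.le,
      Real.rpow_natCast]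
    push_cast
    ring
  refine Tendsto.congr' h1.symm ?_
  rw [show 𝓝 (0 : ℂ) = 𝓝 (∑ _j ∈ Finset.range (n + 1), 0) by rw [Finset.sum_const_zero]]
  refine tendsto_finsetSum _ fun j hj => ?_
  refine Tendsto.zero_mul_isBoundedUnder_le ?_ ⟨|M| ^ j, ?_⟩
  · have := h.tendsto_coeff v (j := j) (by have := Finset.mem_range.1 hj; omega)
    simpa using this.sub_const ((saturated n p P (ofReal v)).coeff j)
  · rw [eventually_map]
    filter_upwards [hz] with ε hε
    simp only [Function.comp_apply, norm_pow]
    exact pow_le_pow_left₀ (norm_nonneg _) (hε.trans (le_abs_self _)) _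

theorem tendsto_eval (h : CoeffsWithEquivalents Q p P c) (hdeg : Q.natDegree = n) (v : ℝ) (z : ℂ) :
    Tendsto (fun ε : ℝ => ((ε ^ (-rootSum c v) : ℝ) : ℂ) *
        (evalAt Q ε).eval (((ε ^ v : ℝ) : ℂ) * z))
      (𝓝[>] 0) (𝓝 ((saturated n p P (ofReal v)).eval z)) := by
  have := (h.tendsto_eval_sub hdeg v (z := fun _ => z) (.of_forall fun _ => le_rfl)).add_const
    ((saturated n p P (ofReal v)).eval z)
  simpa using this

end CoeffsWithEquivalents

/-! ### Connectedness arguments -/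

/-- Each piece is the complement of a finite union of closed sets, so it is clopen. -/
theorem exists_eq_univ_of_closed_cover {X α : Type*} [TopologicalSpace X] [PreconnectedSpace X]
    [Nonempty X] {S : Finset α} {Z : α → Set X} (hcl : ∀ A ∈ S, IsClosed (Z A))
    (hcov : ∀ x, ∃ A ∈ S, x ∈ Z A) (hdisj : ∀ A ∈ S, ∀ B ∈ S, A ≠ B → Disjoint (Z A) (Z B)) :
    ∃ A ∈ S, Z A = Set.univ := by
  classical
  obtain ⟨x⟩ := ‹Nonempty X›
  obtain ⟨A, hA, hx⟩ := hcov x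
  refine ⟨A, hA, IsClopen.eq_univ ⟨hcl A hA, ?_⟩ ⟨x, hx⟩⟩
  have h1 : Z A = (⋃ B ∈ S.erase A, Z B)ᶜ := by
    ext y
    simp only [Set.mem_compl_iff, Set.mem_iUnion, not_exists, Finset.mem_erase]
    constructor
    · rintro hy B ⟨hBA, hB⟩ hyB
      exact Set.disjoint_left.1 (hdisj A hA B hB hBA.symm) hy hyB
    · intro hy
      obtain ⟨B, hB, hyB⟩ := hcov y
      by_cases hBA : B = A
      · exact hBA ▸ hyB
      · exact absurd hyB (hy B ⟨hBA, hB⟩)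
  rw [h1, isOpen_compl_iff]
  exact isClosed_biUnion_finset fun B hB => hcl B (Finset.mem_of_mem_erase hB)

/-- A continuous family with values eventually in one of finitely many disjoint closed pieces stays
in one of them. -/
theorem exists_eventually_of_closed_cover {α : Type*} {S : Finset α} {Z : α → ℝ → Prop} {a : ℝ}
    (ha : 0 < a) (hcl : ∀ b ≤ a, ∀ A ∈ S, IsClosed {ε : Set.Ioo 0 b | Z A ε})
    (hcov : ∀ᶠ ε in 𝓝[>] (0 : ℝ), ∃ A ∈ S, Z A ε)
    (hdisj : ∀ A ∈ S, ∀ B ∈ S, A ≠ B → ∀ᶠ ε in 𝓝[>] (0 : ℝ), ¬(Z A ε ∧ Z B ε)) :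
    ∃ A ∈ S, ∀ᶠ ε in 𝓝[>] (0 : ℝ), Z A ε := by
  have h1 : ∀ᶠ ε in 𝓝[>] (0 : ℝ), ∀ A ∈ S, ∀ B ∈ S, A ≠ B → ¬(Z A ε ∧ Z B ε) := by
    refine (eventually_all_finset _).2 fun A hA => (eventually_all_finset _).2 fun B hB => ?_
    by_cases hAB : A = B
    · exact .of_forall fun _ h => absurd hAB h
    · filter_upwards [hdisj A hA B hB hAB] with ε hε _ using hε
  obtain ⟨b, hb, hbS⟩ := mem_nhdsGT_iff_exists_Ioo_subset.1 (hcov.and h1)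
  have hb0 : 0 < min a b := lt_min ha hb
  have hmem : ∀ ε : Set.Ioo 0 (min a b), (ε : ℝ) ∈ Set.Ioo 0 b := fun ε =>
    ⟨ε.2.1, ε.2.2.trans_le (min_le_right _ _)⟩
  have : PreconnectedSpace (Set.Ioo 0 (min a b)) :=
    isPreconnected_iff_preconnectedSpace.1 isPreconnected_Ioo
  have : Nonempty (Set.Ioo 0 (min a b)) := (Set.nonempty_Ioo.2 hb0).to_subtype
  obtain ⟨A, hA, hAu⟩ := exists_eq_univ_of_closed_cover
    (Z := fun A => {ε : Set.Ioo 0 (min a b) | Z A ε}) (hcl _ (min_le_left _ _))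
    (fun ε => (hbS (hmem ε)).1)
    (fun A hA B hB hAB => Set.disjoint_left.2 fun ε h h' => (hbS (hmem ε)).2 A hA B hB hAB ⟨h, h'⟩)
  refine ⟨A, hA, ?_⟩
  filter_upwards [Ioo_mem_nhdsGT hb0] with ε hε
  exact Set.eq_univ_iff_forall.1 hAu ⟨ε, hε⟩

/-- A continuous function that approaches a finite set converges to one of its points. -/
theorem exists_tendsto_of_approaches {S : Finset ℂ} {z : ℝ → ℂ} {a : ℝ} (ha : 0 < a)
    (hz : ContinuousOn z (Set.Ioo 0 a))
    (hS : ∀ δ > 0, ∀ᶠ ε in 𝓝[>] (0 : ℝ), ∃ s ∈ S, dist (z ε) s ≤ δ) :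
    ∃ s ∈ S, Tendsto z (𝓝[>] 0) (𝓝 s) := by
  have hsep : ∀ᶠ δ in 𝓝[>] (0 : ℝ), ∀ s ∈ S, ∀ t ∈ S, s ≠ t → δ < dist s t / 2 := by
    refine (eventually_all_finset _).2 fun s _ => (eventually_all_finset _).2 fun t _ => ?_
    by_cases hst : s = t
    · exact .of_forall fun _ h => absurd hst h
    · filter_upwards [Ioo_mem_nhdsGT (half_pos (dist_pos.2 hst))] with δ hδ _ using hδ.2
  -- The balls of radius `δ₀` around the points of `S` are disjoint, so the function is trapped in
  -- one of them; closer approximations then concern the same centre.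
  obtain ⟨δ₀, hδ, hδ0⟩ := (hsep.and eventually_pos).exists
  have hd : ∀ s ∈ S, ∀ t ∈ S, s ≠ t → ∀ w, ¬(dist w s ≤ δ₀ ∧ dist w t ≤ δ₀) := by
    rintro s hs t ht hst w ⟨h1, h2⟩
    have := dist_triangle_left s t w
    linarith [hδ s hs t ht hst]
  obtain ⟨s, hs, hsz⟩ := exists_eventually_of_closed_cover (S := S)
    (Z := fun s ε => dist (z ε) s ≤ δ₀) ha
    (fun b hb s _ => by
      refine isClosed_le (Continuous.dist ?_ continuous_const) continuous_const
      exact (hz.mono (Set.Ioo_subset_Ioo_right hb)).domRestrict)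
    (hS δ₀ hδ0) (fun s hs t ht hst => .of_forall fun ε => hd s hs t ht hst _)
  refine ⟨s, hs, Metric.tendsto_nhds.2 fun e he => ?_⟩
  filter_upwards [hsz, hS (min δ₀ (e / 2)) (lt_min hδ0 (half_pos he))] with ε h1 h2
  obtain ⟨t, ht, h3⟩ := h2
  by_cases hst : s = t
  · rw [hst]
    exact (h3.trans (min_le_right _ _)).trans_lt (half_lt_self he)
  · exact absurd ⟨h1, h3.trans (min_le_left _ _)⟩ (hd s hs t ht hst _)

/-- If the values of a nonzero polynomial at `z` tend to `0`, then `z` approaches its roots. -/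
theorem approaches_roots {q : ℂ[X]} (hq : q ≠ 0) {z : ℝ → ℂ} {l : Filter ℝ}
    (hz : Tendsto (fun ε => q.eval (z ε)) l (𝓝 0)) {δ : ℝ} (hδ : 0 < δ) :
    ∀ᶠ ε in l, ∃ s ∈ q.roots.toFinset, dist (z ε) s ≤ δ := by
  -- This is a lower bound for the modulus of `q` at a point at distance at least `δ` from all the
  -- roots.
  have h1 : 0 < ‖q.leadingCoeff‖ * δ ^ q.roots.card :=
    mul_pos (norm_pos_iff.2 (leadingCoeff_ne_zero.2 hq)) (pow_pos hδ _)
  have h2 := (tendsto_zero_iff_norm_tendsto_zero.1 hz).eventually (gt_mem_nhds h1)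
  filter_upwards [h2] with ε hε
  by_contra! hcon
  refine absurd hε (not_lt.2 ?_)
  have h3 : q.eval (z ε) = q.leadingCoeff * (q.roots.map fun s => z ε - s).prod := by
    conv_lhs => rw [(IsAlgClosed.splits q).eq_prod_roots]
    rw [eval_mul, eval_C, eval_multiset_prod, Multiset.map_map]
    simp
  rw [h3, norm_mul]
  refine mul_le_mul_of_nonneg_left ?_ (norm_nonneg _)
  have h4 : ∀ s ∈ q.roots, δ ≤ ‖z ε - s‖ := fun s hs => by
    rw [← dist_eq_norm]
    exact (hcon s (Multiset.mem_toFinset.2 hs)).le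
  generalize q.roots = R at h4
  induction R using Multiset.induction with
  | empty => simp
  | cons s R ih =>
    rw [Multiset.map_cons, Multiset.prod_cons, norm_mul, Multiset.card_cons, pow_succ, mul_comm]
    exact mul_le_mul (h4 s (Multiset.mem_cons_self _ _))
      (ih fun t ht => h4 t (Multiset.mem_cons_of_mem ht)) (pow_nonneg hδ.le _) (norm_nonneg _)

/-! ### Magnitude of the roots -/

theorem norm_rpow_mul (ε s : ℝ) (hε : 0 < ε) (w : ℂ) : ‖((ε ^ s : ℝ) : ℂ) * w‖ = ε ^ s * ‖w‖ := by
  rw [norm_mul, Complex.norm_real, Real.norm_of_nonneg (Real.rpow_nonneg hε.le _)]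

theorem norm_eq_rpow_mul (ε s : ℝ) (hε : 0 < ε) (w : ℂ) :
    ‖w‖ = ε ^ s * ‖((ε ^ (-s) : ℝ) : ℂ) * w‖ := by
  rw [norm_rpow_mul _ _ hε, ← mul_assoc, ← Real.rpow_add hε, add_neg_cancel, Real.rpow_zero, one_mul]

namespace CoeffsWithEquivalents

variable {Q : ModGerm[X]} {p : ℂ[X]} {P : Rmin[X]} {c : Fin n → Rmin}

/-- The lower bound is needed only where `p` does not vanish, since the dominating terms sit at
vertices. -/
theorem exists_coeff_bounds (h : CoeffsWithEquivalents Q p P c) :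
    ∃ C m : ℝ, 0 < C ∧ 0 < m ∧ ∀ᶠ ε in 𝓝[>] (0 : ℝ), ∀ j ∈ Finset.range (n + 1),
      (P.coeff j = 0 → germVal (Q.coeff j) ε = 0) ∧
      ∀ a, P.coeff j = ofReal a → ‖germVal (Q.coeff j) ε‖ ≤ C * ε ^ a ∧
        (p.coeff j ≠ 0 → m * ε ^ a ≤ ‖germVal (Q.coeff j) ε‖) := by
  have hC : ∀ᶠ C : ℝ in atTop, ∀ j ∈ Finset.range (n + 1), ‖p.coeff j‖ < C :=
    (eventually_all_finset _).2 fun j _ => eventually_gt_atTop _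
  have hm : ∀ᶠ m in 𝓝[>] (0 : ℝ), ∀ j ∈ Finset.range (n + 1), p.coeff j ≠ 0 → m < ‖p.coeff j‖ := by
    refine (eventually_all_finset _).2 fun j _ => ?_
    by_cases hj : p.coeff j = 0
    · exact .of_forall fun _ h => absurd hj h
    · filter_upwards [Ioo_mem_nhdsGT (norm_pos_iff.2 hj)] with m hm _ using hm.2
  obtain ⟨C, hC, hC0⟩ := (hC.and (eventually_gt_atTop 0)).exists
  obtain ⟨m, hm, hm0⟩ := (hm.and eventually_pos).exists
  refine ⟨C, m, hC0, hm0, (eventually_all_finset _).2 fun j hj => ?_⟩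
  rcases h.equivalent j (by have := Finset.mem_range.1 hj; omega) with ⟨h1, h2⟩ | ⟨a, h1, h2⟩
  · filter_upwards [(eq_zero_iff _).1 h2] with ε hε
    exact ⟨fun _ => hε, fun a ha => absurd (ha.symm.trans h1) (ofReal_ne_zero a)⟩
  · have h3 := h2.norm.eventually (gt_mem_nhds (hC j hj))
    have h4 : ∀ᶠ ε in 𝓝[>] (0 : ℝ), p.coeff j ≠ 0 →
        m < ‖((ε ^ (-a) : ℝ) : ℂ) * germVal (Q.coeff j) ε‖ := by
      by_cases hp : p.coeff j = 0
      · exact .of_forall fun _ h => absurd hp h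
      · filter_upwards [h2.norm.eventually (lt_mem_nhds (hm j hj hp))] with ε hε _ using hε
    filter_upwards [h3, h4, eventually_pos] with ε h3 h4 hε
    refine ⟨fun h0 => absurd (h1.symm.trans h0) (ofReal_ne_zero a), fun a' ha' => ?_⟩
    obtain rfl : a = a' := ofReal_inj.1 (h1.symm.trans ha')
    have h5 := norm_eq_rpow_mul ε a hε (germVal (Q.coeff j) ε)
    have h6 := Real.rpow_pos_of_pos hε a
    refine ⟨?_, fun hp => ?_⟩
    · rw [h5, mul_comm]
      exact mul_le_mul_of_nonneg_right h3.le h6.le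
    · rw [h5, mul_comm]
      exact mul_le_mul_of_nonneg_left (h4 hp).le h6.le

/-- Away from the min-plus roots, one term of the Newton polygon dominates. -/
theorem dominance (h : CoeffsWithEquivalents Q p P c) {v δ : ℝ} (hδ : 0 < δ)
    (hc : ∀ i, ¬(ofReal (v - δ) < c i ∧ c i < ofReal (v + δ))) :
    ∃ m ≤ n, p.coeff m ≠ 0 ∧ P.coeff m = ofReal (rootSum c v - m * v) ∧
      ∀ j, j ≠ m → ∀ a, P.coeff j = ofReal a → rootSum c v + δ ≤ a + j * v := by
  obtain ⟨h1, h2⟩ := h.vertex_of_gap (by linarith) hc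
  have h3 := rootSum_of_gap c (x := v) (by linarith) (by linarith) hc
  have h4 := rootSum_of_gap c (x := v + δ) (by linarith) le_rfl hc
  refine ⟨countGT c (v - δ), countGT_le _ _, h1, ?_, ?_⟩
  · rw [h2, h3]; congr 1; ring
  · intro j hj a ha
    have h5 := h.roots.rootSum_le h.lead' ha (v - δ)
    have h6 := h.roots.rootSum_le h.lead' ha (v + δ)
    -- A term of smaller index is compared at `v + δ`, one of larger index at `v - δ`. Slopes differ
    -- by at least `1`, which yields the margin `δ`.
    rcases lt_or_gt_of_ne hj with h7 | h7
    · have h8 : (j : ℝ) + 1 ≤ countGT c (v - δ) := by exact_mod_cast h7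
      nlinarith
    · have h8 : (countGT c (v - δ) : ℝ) + 1 ≤ j := by exact_mod_cast h7
      nlinarith

/-- Every nonzero root has the magnitude of some power `ε ^ r` with `r` a min-plus root. -/
theorem exists_magnitude (h : CoeffsWithEquivalents Q p P c) (hdeg : Q.natDegree = n) :
    ∃ M : ℝ, 1 < M ∧ ∀ᶠ ε in 𝓝[>] (0 : ℝ), ∀ w : ℂ, w ≠ 0 → (evalAt Q ε).eval w = 0 →
      ∃ i r, c i = ofReal r ∧ ‖((ε ^ (-r) : ℝ) : ℂ) * w‖ ∈ Set.Icc M⁻¹ M := by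
  obtain ⟨C, m, hC, hm, hb⟩ := h.exists_coeff_bounds
  -- With this choice `n * C / M < m`: the `n` dominated terms cannot cancel the dominating one.
  set M : ℝ := (n + 1) * C / m + 1 with hM
  have hM1 : 1 < M := by rw [hM]; linarith [show 0 < (n + 1) * C / m by positivity]
  have hM0 : 0 < M := by linarith
  refine ⟨M, hM1, ?_⟩
  filter_upwards [hb, Ioo_mem_nhdsGT one_pos] with ε hb hε w hw hroot
  by_contra! hcon
  have hlog : Real.log ε < 0 := Real.log_neg hε.1 hε.2
  have hlogM : 0 < Real.log M := Real.log_pos hM1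
  have hwn : 0 < ‖w‖ := norm_pos_iff.2 hw
  -- Here `‖w‖ = ε ^ v` and `ε ^ δ = M⁻¹`, so a root outside all the annuli means that no `cᵢ` lies
  -- strictly within `δ` of `v`.
  set v := Real.log ‖w‖ / Real.log ε with hv
  set δ := Real.log M / (-Real.log ε) with hδ
  have hδ0 : 0 < δ := div_pos hlogM (neg_pos.2 hlog)
  have hwv : ‖w‖ = ε ^ v := by
    rw [Real.rpow_def_of_pos hε.1, hv, mul_div_cancel₀ _ hlog.ne, Real.exp_log hwn]
  have hMδ : ε ^ (-δ) = M := by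
    rw [Real.rpow_def_of_pos hε.1, hδ, div_neg, neg_neg, mul_div_cancel₀ _ hlog.ne,
      Real.exp_log hM0]
  have hMδ' : ε ^ δ = M⁻¹ := by rw [← hMδ, Real.rpow_neg hε.1.le, inv_inv]
  obtain ⟨j₀, hj₀, hp, hP, hdom⟩ := h.dominance (v := v) hδ0 (by
    rintro i ⟨h1, h2⟩
    rcases eq_zero_or_eq_ofReal (c i) with h3 | ⟨r, h3⟩
    · rw [h3] at h2
      exact lt_asymm h2 (ofReal_lt_zero _)
    · rw [h3, ofReal_lt] at h1 h2
      refine hcon i r h3 ?_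
      rw [norm_rpow_mul _ _ hε.1, hwv, ← Real.rpow_add hε.1, ← hMδ', ← hMδ]
      exact ⟨Real.rpow_le_rpow_of_exponent_ge hε.1 hε.2.le (by linarith),
        Real.rpow_le_rpow_of_exponent_ge hε.1 hε.2.le (by linarith)⟩)
  have hpow : ∀ j : ℕ, ∀ a : ℝ, ε ^ a * ‖w‖ ^ j = ε ^ (a + j * v) := by
    intro j a
    rw [hwv, ← Real.rpow_natCast, ← Real.rpow_mul hε.1.le, ← Real.rpow_add hε.1, mul_comm v]
  set F := ε ^ rootSum c v with hF
  have hF0 : 0 < F := Real.rpow_pos_of_pos hε.1 _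
  have hlow : m * F ≤ ‖germVal (Q.coeff j₀) ε * w ^ j₀‖ := by
    have h1 := ((hb j₀ (by simpa [Nat.lt_succ_iff] using hj₀)).2 _ hP).2 hp
    have h2 := mul_le_mul_of_nonneg_right h1 (pow_nonneg hwn.le j₀)
    rwa [mul_assoc, hpow, sub_add_cancel, ← norm_pow, ← norm_mul] at h2
  have hup : ∀ j ∈ (Finset.range (n + 1)).erase j₀,
      ‖germVal (Q.coeff j) ε * w ^ j‖ ≤ C * F * M⁻¹ := by
    intro j hj
    rw [Finset.mem_erase] at hj
    have h1 := hb j hj.2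
    rcases eq_zero_or_eq_ofReal (P.coeff j) with h2 | ⟨a, h2⟩
    · rw [h1.1 h2, zero_mul, norm_zero]; positivity
    · have h3 := mul_le_mul_of_nonneg_right (h1.2 a h2).1 (pow_nonneg hwn.le j)
      rw [mul_assoc, hpow, ← norm_pow, ← norm_mul] at h3
      refine h3.trans ?_
      rw [mul_assoc, hF, ← hMδ', ← Real.rpow_add hε.1]
      exact mul_le_mul_of_nonneg_left
        (Real.rpow_le_rpow_of_exponent_ge hε.1 hε.2.le (hdom j hj.1 a h2)) hC.le
  have hj₀' : j₀ ∈ Finset.range (n + 1) := by simpa [Nat.lt_succ_iff] using hj₀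
  rw [eval_evalAt hdeg, ← Finset.add_sum_erase _ _ hj₀'] at hroot
  have h1 : ‖germVal (Q.coeff j₀) ε * w ^ j₀‖ ≤ n * (C * F * M⁻¹) := by
    rw [eq_neg_of_add_eq_zero_left hroot, norm_neg]
    refine (norm_sum_le_of_le _ hup).trans_eq ?_
    rw [Finset.sum_const, Finset.card_erase_of_mem hj₀', Finset.card_range, nsmul_eq_mul,
      Nat.add_sub_cancel]
  have h2 : m * M ≤ n * C := by
    have h3 := hlow.trans h1
    have h4 : m * M * F ≤ n * C * F := by
      calc m * M * F = m * F * M := by ring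
        _ ≤ n * (C * F * M⁻¹) * M := mul_le_mul_of_nonneg_right h3 hM0.le
        _ = n * C * F := by field_simp
    exact le_of_mul_le_mul_right h4 hF0
  have h3 : m * M = (n + 1) * C + m := by rw [hM]; field_simp
  nlinarith

/-! ### Asymptotics of a continuous branch of roots -/

/-- Connectedness is used twice. The zero set and the annuli of `exists_magnitude` are closed and
eventually disjoint, so the branch stays in one of them. In an annulus the rescaled branch is
bounded and the saturated polynomial tends to `0` along it, so it converges to one root, nonzero
because of the lower bound `M⁻¹`. -/
theorem exists_asymptotics (h : CoeffsWithEquivalents Q p P c) (hdeg : Q.natDegree = n)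
    (f : ModGerm) (hf : ∀ᶠ ε in 𝓝[>] (0 : ℝ), (evalAt Q ε).eval (germVal f ε) = 0) :
    ∃ (y : ℂ) (Y : Rmin), HasFirstOrderAsymptotics f y Y := by
  classical
  obtain ⟨g, a, k, ha, -, hg, -, hgf⟩ := f.2
  have hfg := germVal_eventuallyEq f g hgf
  obtain ⟨M, hM, hmag⟩ := h.exists_magnitude hdeg
  have hM0 : 0 < M := one_pos.trans hM
  have hcont : ∀ r : ℝ, ContinuousOn (fun ε : ℝ => ((ε ^ (-r) : ℝ) : ℂ) * g ε) (Set.Ioo 0 a) := by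
    intro r
    refine ContinuousOn.mul (Complex.continuous_ofReal.comp_continuousOn ?_) hg
    exact continuousOn_id.rpow_const fun ε hε => Or.inl hε.1.ne'
  let Z : Rmin → ℝ → Prop := fun A ε => (A = 0 ∧ g ε = 0) ∨ ∃ r : ℝ, A = ofReal r ∧
    ‖((ε ^ (-r) : ℝ) : ℂ) * g ε‖ ∈ Set.Icc M⁻¹ M
  obtain ⟨A, -, hA⟩ : ∃ A ∈ insert 0 (Finset.univ.image c), ∀ᶠ ε in 𝓝[>] (0 : ℝ), Z A ε := by
    refine exists_eventually_of_closed_cover (Z := Z) ha ?_ ?_ ?_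
    · intro b hb A _
      dsimp only [Z]
      rcases eq_zero_or_eq_ofReal A with rfl | ⟨r, rfl⟩
      · have h1 : ∀ r, ¬(0 : Rmin) = ofReal r := fun r h => ofReal_ne_zero r h.symm
        simp only [h1, false_and, exists_false, or_false, true_and]
        exact isClosed_singleton.preimage
          (hg.mono (Set.Ioo_subset_Ioo_right hb)).domRestrict
      · simp only [ofReal_ne_zero, false_and, false_or, ofReal_inj, exists_eq_left']
        exact isClosed_Icc.preimage
          ((hcont r).mono (Set.Ioo_subset_Ioo_right hb)).domRestrict.norm
    · filter_upwards [hmag, hf, hfg] with ε h1 h2 h3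
      rw [h3] at h2
      by_cases h0 : g ε = 0
      · exact ⟨0, Finset.mem_insert_self _ _, Or.inl ⟨rfl, h0⟩⟩
      · obtain ⟨i, r, hi, hr⟩ := h1 _ h0 h2
        exact ⟨c i, Finset.mem_insert_of_mem (Finset.mem_image_of_mem c (Finset.mem_univ i)),
          Or.inr ⟨r, hi, hr⟩⟩
    · intro A _ B _ hAB
      dsimp only [Z]
      have key : ∀ r s : ℝ, r < s → ∀ᶠ ε in 𝓝[>] (0 : ℝ),
          ¬(‖((ε ^ (-r) : ℝ) : ℂ) * g ε‖ ∈ Set.Icc M⁻¹ M ∧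
            ‖((ε ^ (-s) : ℝ) : ℂ) * g ε‖ ∈ Set.Icc M⁻¹ M) := by
        intro r s hrs
        -- Two annuli are disjoint once the ratio `ε ^ (s - r)` of their scales is below `M⁻¹ *
        -- M⁻¹`.
        have h1 := (tendsto_zero_iff_norm_tendsto_zero.1 (tendsto_rpow_zero (sub_pos.2 hrs))).eventually
          (gt_mem_nhds (show 0 < M⁻¹ * M⁻¹ by positivity))
        filter_upwards [h1, eventually_pos] with ε h1 h2 h3
        rw [Complex.norm_real, Real.norm_of_nonneg (Real.rpow_nonneg h2.le _)] at h1
        rw [norm_rpow_mul _ _ h2, norm_rpow_mul _ _ h2] at h3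
        have h4 : ε ^ (-r) * ‖g ε‖ = ε ^ (s - r) * (ε ^ (-s) * ‖g ε‖) := by
          rw [← mul_assoc, ← Real.rpow_add h2]; congr 2; ring
        have h5 : ε ^ (s - r) * (ε ^ (-s) * ‖g ε‖) < M⁻¹ * M⁻¹ * M :=
          (mul_le_mul_of_nonneg_left h3.2.2 (Real.rpow_nonneg h2.le _)).trans_lt
            (mul_lt_mul_of_pos_right h1 hM0)
        rw [← h4, mul_assoc, inv_mul_cancel₀ hM0.ne', mul_one] at h5
        exact absurd h3.1.1 (not_le.2 h5)
      have key0 : ∀ r ε : ℝ, g ε = 0 → ¬‖((ε ^ (-r) : ℝ) : ℂ) * g ε‖ ∈ Set.Icc M⁻¹ M := by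
        intro r ε h0 h1
        rw [h0, mul_zero, norm_zero] at h1
        exact absurd h1.1 (not_le.2 (inv_pos.2 hM0))
      rcases eq_zero_or_eq_ofReal A with rfl | ⟨r, rfl⟩ <;>
        rcases eq_zero_or_eq_ofReal B with rfl | ⟨s, rfl⟩
      · exact absurd rfl hAB
      · simp only [ofReal_ne_zero, (ofReal_ne_zero _).symm, false_and, false_or, exists_false,
          or_false, true_and, ofReal_inj, exists_eq_left']
        exact .of_forall fun ε hε => key0 s ε hε.1 hε.2
      · simp only [ofReal_ne_zero, (ofReal_ne_zero _).symm, false_and, false_or, exists_false,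
          or_false, true_and, ofReal_inj, exists_eq_left']
        exact .of_forall fun ε hε => key0 r ε hε.2 hε.1
      · simp only [ofReal_ne_zero, false_and, false_or, ofReal_inj, exists_eq_left']
        rcases lt_or_gt_of_ne (fun h => hAB (h ▸ rfl) : r ≠ s) with hrs | hrs
        · exact key r s hrs
        · filter_upwards [key s r hrs] with ε hε hε' using hε hε'.symm
  rcases eq_zero_or_eq_ofReal A with rfl | ⟨r, rfl⟩
  · refine ⟨0, 0, Or.inl ⟨rfl, (eq_zero_iff f).2 ?_⟩⟩
    filter_upwards [hA, hfg] with ε h1 h2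
    rcases h1 with h1 | ⟨r, h1, -⟩
    · rw [h2, h1.2]
    · exact absurd h1.symm (ofReal_ne_zero r)
  · have hA' : ∀ᶠ ε in 𝓝[>] (0 : ℝ), ‖((ε ^ (-r) : ℝ) : ℂ) * g ε‖ ∈ Set.Icc M⁻¹ M := by
      filter_upwards [hA] with ε h1
      rcases h1 with h1 | ⟨s, h1, h2⟩
      · exact absurd h1.1 (ofReal_ne_zero r)
      · rwa [ofReal_inj.1 h1]
    have hlim := h.tendsto_eval_sub hdeg r (z := fun ε : ℝ => ((ε ^ (-r) : ℝ) : ℂ) * g ε)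
      (hA'.mono fun ε hε => hε.2)
    have hlim' : Tendsto (fun ε : ℝ =>
        (saturated n p P (ofReal r)).eval (((ε ^ (-r) : ℝ) : ℂ) * g ε)) (𝓝[>] 0) (𝓝 0) := by
      have hneg := hlim.neg
      rw [neg_zero] at hneg
      refine hneg.congr' ?_
      filter_upwards [hf, hfg, eventually_pos] with ε h1 h2 h3
      rw [← mul_assoc, ← Complex.ofReal_mul, ← Real.rpow_add h3, add_neg_cancel, Real.rpow_zero,
        Complex.ofReal_one, one_mul, ← h2, h1, mul_zero, zero_sub, neg_neg]
    obtain ⟨s, -, hs⟩ := exists_tendsto_of_approaches ha (hcont r)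
      fun δ hδ => approaches_roots (h.saturated_ne_zero r) hlim' hδ
    refine ⟨s, ofReal r, Or.inr ⟨r, rfl, ?_, ?_⟩⟩
    · have h1 : M⁻¹ ≤ ‖s‖ := ge_of_tendsto hs.norm (hA'.mono fun ε hε => hε.1)
      exact norm_pos_iff.1 ((inv_pos.2 hM0).trans_le h1)
    · refine hs.congr' ?_
      filter_upwards [hfg] with ε hε
      rw [hε]

/-- The roots have first order asymptotics. -/
theorem exists_rootsWithAsymptotics (h : CoeffsWithEquivalents Q p P c) (hdeg : Q.natDegree = n)
    (hlead : Q.coeff n = 1) : ∃ (rt : Fin n → ModGerm) (y : Fin n → ℂ) (Y : Fin n → Rmin),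
      RootsWithAsymptotics Q rt y Y := by
  obtain ⟨rt, hrt⟩ := exists_root_germs hdeg hlead
  have h1 : ∀ i, ∃ (y : ℂ) (Y : Rmin), HasFirstOrderAsymptotics (rt i) y Y := by
    intro i
    refine h.exists_asymptotics hdeg (rt i) ?_
    filter_upwards [hrt] with ε hε
    rw [hε, rootPoly_eval]
    exact Finset.prod_eq_zero (Finset.mem_univ i) (sub_self _)
  choose y Y hY using h1
  refine ⟨rt ∘ Tuple.sort Y, y ∘ Tuple.sort Y, Y ∘ Tuple.sort Y, ?_, fun j => hY _,
    Tuple.monotone_sort Y⟩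
  refine (roots_evalAt_iff hdeg hlead fun ε j => germVal ((rt ∘ Tuple.sort Y) j) ε).2 ?_
  filter_upwards [hrt] with ε hε
  rw [hε]
  exact (rootPoly_comp_perm (fun j => germVal (rt j) ε) (Tuple.sort Y)).symm

end CoeffsWithEquivalents

/-! ### Calculus of first order equivalents -/

/-- The relation `f ε ≃ a ε ^ A` for functions of `ε`. -/
def WeakEquiv (f : ℝ → ℂ) (a : ℂ) (A : Rmin) : Prop :=
  (A = 0 ∧ ∀ᶠ ε in 𝓝[>] (0 : ℝ), f ε = 0) ∨ ∃ r : ℝ, A = ofReal r ∧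
    Tendsto (fun ε : ℝ => ((ε ^ (-r) : ℝ) : ℂ) * f ε) (𝓝[>] 0) (𝓝 a)

theorem hasWeakEquivalent_iff {f : ModGerm} {a : ℂ} {A : Rmin} :
    HasWeakEquivalent f a A ↔ WeakEquiv (germVal f) a A := by
  rw [HasWeakEquivalent, WeakEquiv, eq_zero_iff]

theorem HasFirstOrderAsymptotics.weakEquiv {f : ModGerm} {a : ℂ} {A : Rmin}
    (h : HasFirstOrderAsymptotics f a A) : WeakEquiv (germVal f) a A := by
  rcases h with ⟨h1, h2⟩ | ⟨r, h1, -, h2⟩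
  · exact Or.inl ⟨h1, (eq_zero_iff f).1 h2⟩
  · exact Or.inr ⟨r, h1, h2⟩

theorem HasFirstOrderAsymptotics.ne_zero {f : ModGerm} {a : ℂ} {A : Rmin}
    (h : HasFirstOrderAsymptotics f a A) (hA : A ≠ 0) : a ≠ 0 := by
  rcases h with ⟨h1, -⟩ | ⟨r, -, h1, -⟩
  · exact absurd h1 hA
  · exact h1

namespace WeakEquiv

variable {f g : ℝ → ℂ} {a b : ℂ} {A B : Rmin}

theorem congr (h : WeakEquiv f a A) (hfg : f =ᶠ[𝓝[>] 0] g) : WeakEquiv g a A := by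
  rcases h with ⟨h1, h2⟩ | ⟨r, h1, h2⟩
  · refine Or.inl ⟨h1, ?_⟩
    filter_upwards [h2, hfg] with ε h3 h4
    rw [← h4, h3]
  · exact Or.inr ⟨r, h1, h2.congr' (hfg.mono fun ε hε => by rw [hε])⟩

theorem neg (h : WeakEquiv f a A) : WeakEquiv (fun ε => -f ε) (-a) A := by
  rcases h with ⟨h1, h2⟩ | ⟨r, h1, h2⟩
  · exact Or.inl ⟨h1, h2.mono fun ε hε => by simp only [hε, neg_zero]⟩
  · refine Or.inr ⟨r, h1, ?_⟩
    simpa only [mul_neg] using h2.neg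

theorem one : WeakEquiv (fun _ => 1) 1 1 := by
  refine Or.inr ⟨0, rfl, ?_⟩
  simp

theorem mul (hf : WeakEquiv f a A) (hg : WeakEquiv g b B) :
    WeakEquiv (fun ε => f ε * g ε) (a * b) (A * B) := by
  rcases hf with ⟨rfl, hf⟩ | ⟨r, rfl, hf⟩
  · exact Or.inl ⟨zero_mul _, hf.mono fun ε hε => by simp only [hε, zero_mul]⟩
  rcases hg with ⟨rfl, hg⟩ | ⟨s, rfl, hg⟩
  · exact Or.inl ⟨mul_zero _, hg.mono fun ε hε => by simp only [hε, mul_zero]⟩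
  refine Or.inr ⟨r + s, ofReal_add r s, (hf.mul hg).congr' ?_⟩
  filter_upwards [eventually_pos] with ε hε
  rw [neg_add, Real.rpow_add hε]
  push_cast
  ring

theorem prod {ι : Type*} {s : Finset ι} {f : ι → ℝ → ℂ} {a : ι → ℂ} {A : ι → Rmin}
    (h : ∀ i ∈ s, WeakEquiv (f i) (a i) (A i)) :
    WeakEquiv (fun ε => ∏ i ∈ s, f i ε) (∏ i ∈ s, a i) (∏ i ∈ s, A i) := by
  classical
  induction s using Finset.induction_on with
  | empty => simpa using one
  | insert i s hi ih =>
    simp only [Finset.prod_insert hi]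
    exact (h i (Finset.mem_insert_self _ _)).mul
      (ih fun j hj => h j (Finset.mem_insert_of_mem hj))

theorem tendsto_of_lt {r : ℝ} (hg : WeakEquiv g b B) (hB : ofReal r < B) :
    Tendsto (fun ε : ℝ => ((ε ^ (-r) : ℝ) : ℂ) * g ε) (𝓝[>] 0) (𝓝 0) := by
  rcases hg with ⟨-, hg⟩ | ⟨s, rfl, hg⟩
  · exact tendsto_const_nhds.congr' (hg.mono fun ε hε => by simp only [hε, mul_zero])
  · have h1 := (tendsto_rpow_zero (sub_pos.2 (ofReal_lt.1 hB))).mul hg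
    rw [zero_mul] at h1
    refine h1.congr' ?_
    filter_upwards [eventually_pos] with ε hε
    rw [← mul_assoc, ← Complex.ofReal_mul, ← Real.rpow_add hε]
    congr 3; ring

theorem add_of_lt (hf : WeakEquiv f a A) (hg : WeakEquiv g b B) (h : A < B) :
    WeakEquiv (fun ε => f ε + g ε) a A := by
  rcases hf with ⟨rfl, -⟩ | ⟨r, rfl, hf⟩
  · exact absurd (Tropical.le_zero B) (not_le.2 h)
  · refine Or.inr ⟨r, rfl, ?_⟩
    simpa only [mul_add, add_zero] using hf.add (hg.tendsto_of_lt h)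

/-- For equal exponents the leading coefficients may cancel, leaving the coefficient `0`; this is
why the coefficients of the polynomial are only required to satisfy `≃`. -/
theorem exists_add (hf : WeakEquiv f a A) (hg : WeakEquiv g b B) :
    ∃ e, WeakEquiv (fun ε => f ε + g ε) e (A + B) := by
  rcases lt_trichotomy A B with h | rfl | h
  · exact ⟨a, by rw [Tropical.add_eq_left h.le]; exact hf.add_of_lt hg h⟩
  · rw [Tropical.add_self]
    rcases hf with ⟨rfl, hf⟩ | ⟨r, rfl, hf⟩
    · rcases hg with ⟨-, hg⟩ | ⟨s, hs, hg⟩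
      · exact ⟨0, Or.inl ⟨rfl, (hf.and hg).mono fun ε hε => by simp only [hε.1, hε.2, add_zero]⟩⟩
      · exact absurd hs.symm (ofReal_ne_zero s)
    · rcases hg with ⟨hs, hg⟩ | ⟨s, hs, hg⟩
      · exact absurd hs (ofReal_ne_zero r)
      · obtain rfl := ofReal_inj.1 hs
        exact ⟨a + b, Or.inr ⟨r, rfl, by simpa only [mul_add] using hf.add hg⟩⟩
  · refine ⟨b, ?_⟩
    rw [Tropical.add_eq_right h.le]
    simpa only [add_comm] using hg.add_of_lt hf h

theorem exists_sum {ι : Type*} {s : Finset ι} {f : ι → ℝ → ℂ} {a : ι → ℂ} {A : ι → Rmin}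
    (h : ∀ i ∈ s, WeakEquiv (f i) (a i) (A i)) :
    ∃ e, WeakEquiv (fun ε => ∑ i ∈ s, f i ε) e (∑ i ∈ s, A i) := by
  classical
  induction s using Finset.induction_on with
  | empty => exact ⟨0, Or.inl (by simp)⟩
  | insert i s hi ih =>
    simp only [Finset.sum_insert hi]
    obtain ⟨e, he⟩ := ih fun j hj => h j (Finset.mem_insert_of_mem hj)
    exact (h i (Finset.mem_insert_self _ _)).exists_add he

/-- A sum with a unique term of smallest exponent is equivalent to that term. -/
theorem sum_of_lt {ι : Type*} {s : Finset ι} {f : ι → ℝ → ℂ} {a : ι → ℂ} {A : ι → Rmin}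
    (h : ∀ i ∈ s, WeakEquiv (f i) (a i) (A i)) {i : ι} (hi : i ∈ s) (hA : A i ≠ 0)
    (hlt : ∀ j ∈ s, j ≠ i → A i < A j) :
    WeakEquiv (fun ε => ∑ j ∈ s, f j ε) (a i) (∑ j ∈ s, A j) := by
  classical
  obtain ⟨e, he⟩ := exists_sum fun j (hj : j ∈ s.erase i) => h j (Finset.mem_of_mem_erase hj)
  have h1 : A i < ∑ j ∈ s.erase i, A j := by
    rcases (s.erase i).eq_empty_or_nonempty with h0 | h0
    · rw [h0, Finset.sum_empty]
      exact lt_of_le_of_ne (Tropical.le_zero _) hA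
    · obtain ⟨j, hj, h2⟩ := exists_sum_eq h0 A
      rw [h2]
      exact hlt j (Finset.mem_of_mem_erase hj) (Finset.ne_of_mem_erase hj)
  simp only [← Finset.add_sum_erase s _ hi]
  rw [Tropical.add_eq_left h1.le]
  exact (h i hi).add_of_lt he h1

end WeakEquiv

/-! ### Coefficients in terms of the roots -/

/-- The min-plus polynomial with prescribed roots. -/
def minPlusPoly (c : Fin n → Rmin) : Rmin[X] := ∏ i, (X + C (c i))

theorem minPlusPoly_monic (c : Fin n → Rmin) : (minPlusPoly c).Monic :=
  monic_prod_of_monic _ _ fun i _ => monic_X_add_C (c i)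

theorem minPlusPoly_natDegree (c : Fin n → Rmin) : (minPlusPoly c).natDegree = n := by
  rw [minPlusPoly, natDegree_prod_of_monic _ _ fun i _ => monic_X_add_C (c i)]
  simp

theorem minPlusPoly_coeff (c : Fin n → Rmin) {j : ℕ} (hj : j ≤ n) :
    (minPlusPoly c).coeff j =
      ∑ t ∈ (Finset.univ : Finset (Fin n)).powersetCard (n - j), ∏ i ∈ t, c i := by
  rw [minPlusPoly, Finset.prod_X_add_C_coeff _ _ (by simpa using hj)]
  simp

theorem rootPoly_coeff (x : Fin n → ℂ) {j : ℕ} (hj : j ≤ n) :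
    (rootPoly x).coeff j =
      ∑ t ∈ (Finset.univ : Finset (Fin n)).powersetCard (n - j), ∏ i ∈ t, -x i := by
  have : rootPoly x = ∏ i, (X + C (-x i)) := by simp [rootPoly, sub_eq_add_neg]
  rw [this, Finset.prod_X_add_C_coeff _ _ (by simpa using hj)]
  simp

theorem minPlusPoly_coeff_self (c : Fin n → Rmin) : (minPlusPoly c).coeff n = 1 := by
  have h := minPlusPoly_monic c
  rwa [Monic, leadingCoeff, minPlusPoly_natDegree] at h

theorem isMinPlusRoots_minPlusPoly {c : Fin n → Rmin} (hc : Monotone c) :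
    IsMinPlusRoots (minPlusPoly c) c where
  degree_eq := by
    rw [degree_eq_natDegree (minPlusPoly_monic c).ne_zero, minPlusPoly_natDegree]
  monotone := hc
  eval_eq y := by
    rw [minPlusPoly_coeff_self, one_mul, minPlusPoly, eval_prod]
    simp

theorem prod_ne_zero_of_forall {ι : Type*} {s : Finset ι} {c : ι → Rmin}
    (h : ∀ i ∈ s, c i ≠ 0) : ∏ i ∈ s, c i ≠ 0 := Finset.prod_ne_zero_iff.2 h

theorem pow_card_le_prod_rmin {ι : Type*} (s : Finset ι) {c : ι → Rmin} {v : Rmin}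
    (h : ∀ i ∈ s, v ≤ c i) : v ^ s.card ≤ ∏ i ∈ s, c i := by
  classical
  induction s using Finset.induction_on with
  | empty => simp
  | insert i s hi ih =>
    rw [Finset.card_insert_of_notMem hi, Finset.prod_insert hi, pow_succ']
    exact mul_le_mul_of_le (h i (Finset.mem_insert_self _ _))
      (ih fun j hj => h j (Finset.mem_insert_of_mem hj))

theorem prod_le_pow_card_rmin {ι : Type*} (s : Finset ι) {c : ι → Rmin} {v : Rmin}
    (h : ∀ i ∈ s, c i ≤ v) : ∏ i ∈ s, c i ≤ v ^ s.card := by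
  classical
  induction s using Finset.induction_on with
  | empty => simp
  | insert i s hi ih =>
    rw [Finset.card_insert_of_notMem hi, Finset.prod_insert hi, pow_succ']
    exact mul_le_mul_of_le (h i (Finset.mem_insert_self _ _))
      (ih fun j hj => h j (Finset.mem_insert_of_mem hj))

/-- The terms of `c` that are at most `v`. -/
def lowSet (c : Fin n → Rmin) (v : ℝ) : Finset (Fin n) :=
  Finset.univ.filter fun i => c i ≤ ofReal v

theorem mem_lowSet {c : Fin n → Rmin} {v : ℝ} {i : Fin n} : i ∈ lowSet c v ↔ c i ≤ ofReal v := by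
  simp [lowSet]

theorem card_lowSet (c : Fin n → Rmin) (v : ℝ) : (lowSet c v).card = n - countGT c v := by
  have h := Finset.card_filter_add_card_filter_not (s := (Finset.univ : Finset (Fin n)))
    (fun i => ofReal v < c i)
  simp only [not_lt, Finset.card_univ, Fintype.card_fin] at h
  rw [lowSet, countGT]
  omega

theorem ne_zero_of_mem_lowSet {c : Fin n → Rmin} {v : ℝ} {i : Fin n} (hi : i ∈ lowSet c v) :
    c i ≠ 0 := by
  have := (mem_lowSet.1 hi).trans_lt (ofReal_lt_zero v)
  exact this.ne

/-- Among the subsets of its size, `lowSet c v` is the only one with smallest product. -/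
theorem prod_lowSet_lt {c : Fin n → Rmin} {v : ℝ} {t : Finset (Fin n)}
    (ht : t.card = (lowSet c v).card) (hne : t ≠ lowSet c v) :
    ∏ i ∈ lowSet c v, c i < ∏ i ∈ t, c i := by
  set u := lowSet c v with hu
  -- Indices outside `lowSet c v` have terms at least `h > v`, so each exchange strictly increases
  -- the product, the common factor being finite.
  obtain ⟨h, hv, hgap⟩ := exists_gap_right c v
  have hcard : (u \ t).card = (t \ u).card := by
    have h1 := Finset.card_sdiff_add_card_inter u t
    have h2 := Finset.card_sdiff_add_card_inter t u
    rw [Finset.inter_comm] at h2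
    omega
  have hpos : 0 < (u \ t).card := by
    rw [Finset.card_pos, Finset.sdiff_nonempty]
    exact fun hut => hne (Finset.eq_of_subset_of_card_le hut ht.le).symm
  have h1 : ∏ i ∈ u \ t, c i ≤ ofReal v ^ (u \ t).card :=
    prod_le_pow_card_rmin _ fun i hi => mem_lowSet.1 (Finset.mem_sdiff.1 hi).1
  have h2 : ofReal h ^ (u \ t).card ≤ ∏ i ∈ t \ u, c i := by
    rw [hcard]
    refine pow_card_le_prod_rmin _ fun i hi => not_lt.1 fun hlt => hgap i ⟨?_, hlt⟩
    exact not_le.1 fun hle => (Finset.mem_sdiff.1 hi).2 (mem_lowSet.2 hle)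
  have h3 : ∏ i ∈ u ∩ t, c i ≠ 0 := prod_ne_zero_of_forall fun i hi =>
    ne_zero_of_mem_lowSet (Finset.mem_inter.1 hi).1
  obtain ⟨a, ha⟩ := (eq_zero_or_eq_ofReal _).resolve_left h3
  calc ∏ i ∈ u, c i = (∏ i ∈ u ∩ t, c i) * ∏ i ∈ u \ t, c i :=
        (Finset.prod_inter_mul_prod_sdiff u t c).symm
    _ ≤ ofReal a * ofReal v ^ (u \ t).card := mul_le_mul_of_le ha.le h1
    _ < ofReal a * ofReal h ^ (u \ t).card := by
        rw [← ofReal_natCast_mul, ← ofReal_natCast_mul, ← ofReal_add, ← ofReal_add, ofReal_lt]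
        have : (0 : ℝ) < (u \ t).card := by exact_mod_cast hpos
        nlinarith
    _ ≤ (∏ i ∈ t ∩ u, c i) * ∏ i ∈ t \ u, c i := by
        rw [Finset.inter_comm t u]
        exact mul_le_mul_of_le ha.ge h2
    _ = ∏ i ∈ t, c i := Finset.prod_inter_mul_prod_sdiff t u c

namespace RootsWithAsymptotics

variable {Q : ModGerm[X]} {rt : Fin n → ModGerm} {y : Fin n → ℂ} {Y : Fin n → Rmin}

/-- By Viète the coefficient is a sum of products of `n - j` roots, whose exponents have the
coefficient of `minPlusPoly Y` as minimum. When `j = countGT Y v`, that minimum is attained only by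
`lowSet Y v`, and the leading coefficient is a product of nonzero `-yᵢ`. -/
theorem exists_coeff_equivalent (h : RootsWithAsymptotics Q rt y Y) (hdeg : Q.natDegree = n)
    (hlead : Q.coeff n = 1) {j : ℕ} (hj : j ≤ n) :
    ∃ a, HasWeakEquivalent (Q.coeff j) a ((minPlusPoly Y).coeff j) ∧
      ∀ v, countGT Y v = j → a ≠ 0 := by
  have hQ : (fun ε => ∑ t ∈ (Finset.univ : Finset (Fin n)).powersetCard (n - j),
      ∏ i ∈ t, -germVal (rt i) ε) =ᶠ[𝓝[>] 0] germVal (Q.coeff j) := by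
    filter_upwards [(roots_evalAt_iff hdeg hlead fun ε j => germVal (rt j) ε).1 h.roots_eq]
      with ε hε
    rw [← coeff_evalAt hdeg ε hj, hε, rootPoly_coeff _ hj]
  have hprod : ∀ t ∈ (Finset.univ : Finset (Fin n)).powersetCard (n - j),
      WeakEquiv (fun ε => ∏ i ∈ t, -germVal (rt i) ε) (∏ i ∈ t, -y i) (∏ i ∈ t, Y i) :=
    fun t _ => WeakEquiv.prod fun i _ => (h.asymptotics i).weakEquiv.neg
  rw [minPlusPoly_coeff _ hj]
  by_cases hv : ∃ v, countGT Y v = j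
  · obtain ⟨v, rfl⟩ := hv
    have hmem : lowSet Y v ∈ (Finset.univ : Finset (Fin n)).powersetCard (n - countGT Y v) :=
      Finset.mem_powersetCard.2 ⟨Finset.subset_univ _, card_lowSet Y v⟩
    refine ⟨∏ i ∈ lowSet Y v, -y i, hasWeakEquivalent_iff.2 (WeakEquiv.congr ?_ hQ), fun _ _ => ?_⟩
    · refine WeakEquiv.sum_of_lt hprod hmem
        (prod_ne_zero_of_forall fun i hi => ne_zero_of_mem_lowSet hi) fun t ht hne => ?_
      exact prod_lowSet_lt (by rw [(Finset.mem_powersetCard.1 ht).2, card_lowSet]) hne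
    · exact Finset.prod_ne_zero_iff.2 fun i hi =>
        neg_ne_zero.2 ((h.asymptotics i).ne_zero (ne_zero_of_mem_lowSet hi))
  · obtain ⟨e, he⟩ := WeakEquiv.exists_sum hprod
    exact ⟨e, hasWeakEquivalent_iff.2 (he.congr hQ), fun v h => absurd ⟨v, h⟩ hv⟩

theorem exists_coeffsWithEquivalents (h : RootsWithAsymptotics Q rt y Y) (hdeg : Q.natDegree = n)
    (hlead : Q.coeff n = 1) :
    ∃ (p : ℂ[X]) (P : Rmin[X]) (c : Fin n → Rmin), CoeffsWithEquivalents Q p P c := by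
  choose! a ha hav using fun j (hj : j ≤ n) => h.exists_coeff_equivalent hdeg hlead hj
  let p : ℂ[X] := X ^ n + ∑ j ∈ Finset.range n, monomial j (a j)
  have hp : ∀ j, p.coeff j = (if j = n then 1 else 0) + if j < n then a j else 0 := by
    intro j
    simp only [p, coeff_add, coeff_X_pow, finsetSum_coeff, coeff_monomial, Finset.sum_ite_eq',
      Finset.mem_range]
  have hpn : p.coeff n = 1 := by simp [hp]
  have hpj : ∀ j < n, p.coeff j = a j := fun j hj => by simp [hp, hj, hj.ne]
  have hroots := isMinPlusRoots_minPlusPoly h.monotone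
  refine ⟨p, minPlusPoly Y, Y, ?_, (minPlusPoly_natDegree Y).le, ?_, hpn, minPlusPoly_coeff_self Y,
    ?_, hroots, ?_⟩
  · refine natDegree_le_iff_coeff_eq_zero.2 fun j hj => ?_
    rw [hp, if_neg (by omega), if_neg (by omega), add_zero]
  · intro j hj
    rcases hj.eq_or_lt with rfl | hj'
    · rw [hpn, minPlusPoly_coeff_self, hlead, hasWeakEquivalent_iff]
      exact WeakEquiv.one.congr (germVal_one.mono fun ε hε => hε.symm)
    · rw [hpj j hj']
      exact ha j hj
  · rcases Nat.eq_zero_or_pos n with rfl | hn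
    · exact Or.inl (hpn ▸ one_ne_zero)
    -- If the largest exponent is infinite, so is the constant coefficient; otherwise no exponent
    -- exceeds it and index `0` is a vertex.
    · rcases eq_zero_or_eq_ofReal (Y ⟨n - 1, by omega⟩) with h0 | ⟨v, hv⟩
      · right
        rw [coeff_zero_eq_eval_zero, hroots.eval_eq,
          Finset.prod_eq_zero (Finset.mem_univ (⟨n - 1, by omega⟩ : Fin n)) (by rw [h0, add_zero]),
          mul_zero]
      · left
        rw [hpj 0 hn]
        refine hav 0 (Nat.zero_le _) v ?_
        have := (monotone_lt_iff h.monotone v ⟨n - 1, by omega⟩).not.1 hv.le.not_gt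
        dsimp only at this
        omega
  · intro i h1 h2 hlt
    rw [hpj _ (by omega)]
    rcases eq_zero_or_eq_ofReal (Y ⟨i - 1, by omega⟩) with h0 | ⟨v, hv⟩
    · rw [h0] at hlt
      exact absurd hlt (Tropical.le_zero (Y ⟨i, h2⟩)).not_gt
    · refine hav _ (by omega) v ?_
      have h3 := (monotone_lt_iff h.monotone v ⟨i - 1, by omega⟩).not.1 hv.le.not_gt
      have h4 := (monotone_lt_iff h.monotone v ⟨i, h2⟩).1 (hv ▸ hlt)
      dsimp only at h3 h4
      omega

end RootsWithAsymptotics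

/-! ### Exponents -/

/-- For each `s < r` the modulus of `f ε` is eventually at most `ε ^ s`; dividing logarithms by `log
ε < 0` reverses the inequality. -/
theorem le_exponentE {f : ModGerm} {a : ℂ} {r : ℝ} (h : WeakEquiv (germVal f) a (ofReal r)) :
    (r : EReal) ≤ exponentE f := by
  refine EReal.ge_of_forall_gt_iff_ge.1 fun s hs => ?_
  rw [EReal.coe_lt_coe_iff] at hs
  refine le_liminf_of_le (by isBoundedDefault) ?_
  have h1 := (tendsto_zero_iff_norm_tendsto_zero.1
    (h.tendsto_of_lt (ofReal_lt.2 hs))).eventually (gt_mem_nhds one_pos)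
  filter_upwards [h1, Ioo_mem_nhdsGT one_pos] with ε h2 hε
  rw [logRatio]
  split_ifs with h0
  · exact le_top
  · rw [EReal.coe_le_coe_iff, le_div_iff_of_neg (Real.log_neg hε.1 hε.2), ← Real.log_rpow hε.1]
    refine Real.log_le_log (norm_pos_iff.2 h0) ?_
    rw [norm_eq_rpow_mul ε s hε.1]
    exact mul_le_of_le_one_right (Real.rpow_nonneg hε.1.le _) h2.le

theorem exponentE_le {f : ModGerm} {a : ℂ} {r : ℝ} (h : WeakEquiv (germVal f) a (ofReal r))
    (ha : a ≠ 0) : exponentE f ≤ r := by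
  refine EReal.le_of_forall_lt_iff_le.1 fun s hs => ?_
  rw [EReal.coe_lt_coe_iff] at hs
  obtain ⟨h0, -⟩ | ⟨r', hr, hlim⟩ := h
  · exact absurd h0 (ofReal_ne_zero r)
  obtain rfl := ofReal_inj.1 hr
  obtain ⟨m, hm0, hm⟩ := exists_between (norm_pos_iff.2 ha)
  have h1 := hlim.norm.eventually (lt_mem_nhds hm)
  have h2 := (tendsto_zero_iff_norm_tendsto_zero.1
    (tendsto_rpow_zero (sub_pos.2 hs))).eventually (gt_mem_nhds hm0)
  refine liminf_le_of_frequently_le' (Eventually.frequently ?_)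
  filter_upwards [h1, h2, Ioo_mem_nhdsGT one_pos] with ε h3 h4 hε
  rw [Complex.norm_real, Real.norm_of_nonneg (Real.rpow_nonneg hε.1.le _)] at h4
  have h5 : ε ^ s ≤ ‖germVal f ε‖ := by
    rw [norm_eq_rpow_mul ε r hε.1 (germVal f ε)]
    calc ε ^ s = ε ^ r * ε ^ (s - r) := by rw [← Real.rpow_add hε.1]; congr 1; ring
      _ ≤ _ := mul_le_mul_of_nonneg_left (h4.trans h3).le (Real.rpow_nonneg hε.1.le _)
  have h6 : 0 < ε ^ s := Real.rpow_pos_of_pos hε.1 s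
  rw [logRatio, if_neg (norm_pos_iff.1 (h6.trans_le h5)), EReal.coe_le_coe_iff,
    div_le_iff_of_neg (Real.log_neg hε.1 hε.2), ← Real.log_rpow hε.1]
  exact Real.log_le_log h6 h5

theorem le_exponent {f : ModGerm} {a : ℂ} {A : Rmin} (h : HasWeakEquivalent f a A) :
    A ≤ exponent f := by
  rcases eq_zero_or_eq_ofReal A with rfl | ⟨r, rfl⟩
  · rcases h with ⟨-, rfl⟩ | ⟨r, h, -⟩
    · exact exponent_zero.ge
    · exact absurd h.symm (ofReal_ne_zero r)
  · rw [← toEReal_le, exponent, toEReal_ofEReal, toEReal_ofReal]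
    exact le_exponentE (hasWeakEquivalent_iff.1 h)

theorem exponent_eq {f : ModGerm} {a : ℂ} {A : Rmin} (h : HasWeakEquivalent f a A)
    (ha : a ≠ 0 ∨ A = 0) : exponent f = A := by
  refine le_antisymm ?_ (le_exponent h)
  rcases eq_zero_or_eq_ofReal A with rfl | ⟨r, rfl⟩
  · exact Tropical.le_zero _
  · rw [← toEReal_le, exponent, toEReal_ofEReal, toEReal_ofReal]
    exact exponentE_le (hasWeakEquivalent_iff.1 h) (ha.resolve_right (ofReal_ne_zero r))

/-! ### The Newton polygon of the exponents -/

theorem vex_congr {f g : ℝ → EReal}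
    (h1 : {q : ℝ × ℝ | f q.1 ≤ (q.2 : EReal)} ⊆ convexHull ℝ {q : ℝ × ℝ | g q.1 ≤ (q.2 : EReal)})
    (h2 : {q : ℝ × ℝ | g q.1 ≤ (q.2 : EReal)} ⊆ convexHull ℝ {q : ℝ × ℝ | f q.1 ≤ (q.2 : EReal)})
    (x : ℝ) : vex f x = vex g x := by
  rw [vex, vex, (convexHull_min h1 (convex_convexHull ℝ _)).antisymm
    (convexHull_min h2 (convex_convexHull ℝ _))]

/-- The convex hull of two points of a line, moved up, contains the points above the segment. -/
theorem mem_convexHull_of_line {S : Set (ℝ × ℝ)} {x₁ x₂ k r b v : ℝ} (h1 : x₁ ≤ k) (h2 : k ≤ x₂)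
    (h12 : x₁ < x₂) (hr : b - k * v ≤ r)
    (hS : ∀ s, 0 ≤ s → (x₁, b - x₁ * v + s) ∈ S ∧ (x₂, b - x₂ * v + s) ∈ S) :
    (k, r) ∈ convexHull ℝ S := by
  obtain ⟨hS1, hS2⟩ := hS (r - (b - k * v)) (sub_nonneg.2 hr)
  have hpos : 0 < x₂ - x₁ := sub_pos.2 h12
  have h3 : (x₂ - k) / (x₂ - x₁) + (k - x₁) / (x₂ - x₁) = 1 := by field_simp; ring
  have h4 := (convex_convexHull ℝ S) (subset_convexHull ℝ S hS1) (subset_convexHull ℝ S hS2)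
    (div_nonneg (sub_nonneg.2 h2) hpos.le) (div_nonneg (sub_nonneg.2 h1) hpos.le) h3
  convert h4 using 1
  ext
  · simp only [Prod.fst_add, Prod.smul_fst, smul_eq_mul]
    field_simp
    ring
  · simp only [Prod.snd_add, Prod.smul_snd, smul_eq_mul]
    field_simp
    ring

theorem le_minReal {c : Rmin} {v : ℝ} (hv : 0 ≤ v) :
    minReal 0 c + (if c = 0 then 1 else 0) * v ≤ minReal v c := by
  rcases eq_zero_or_eq_ofReal c with rfl | ⟨r, rfl⟩
  · rw [minReal_zero, minReal_zero, if_pos rfl]; linarith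
  · rw [minReal_ofReal, minReal_ofReal, if_neg (ofReal_ne_zero r), zero_mul, add_zero]
    exact min_le_min_right r hv

/-- At least `k + 1` roots are infinite, so the polynomial function grows with slope at least `k +
1` and cannot stay below a finite term of slope `k`. -/
theorem IsMinPlusRoots.coeff_eq_zero {P : Rmin[X]} {c : Fin n → Rmin} (h : IsMinPlusRoots P c)
    (h1 : P.coeff n = 1) {k : ℕ} (hk : k < n) (hc : c ⟨n - 1 - k, by omega⟩ = 0) :
    P.coeff k = 0 := by
  rcases eq_zero_or_eq_ofReal (P.coeff k) with h0 | ⟨a, ha⟩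
  · exact h0
  exfalso
  have hcard : (k + 1 : ℕ) ≤ (Finset.univ.filter fun i => c i = 0).card := by
    have hsub : Finset.Ici (⟨n - 1 - k, by omega⟩ : Fin n) ⊆ Finset.univ.filter fun i => c i = 0 := by
      intro j hj
      rw [Finset.mem_filter]
      refine ⟨Finset.mem_univ _, le_antisymm (Tropical.le_zero _) ?_⟩
      rw [← hc]
      exact h.monotone (Finset.mem_Ici.1 hj)
    have := Finset.card_le_card hsub
    rw [Fin.card_Ici] at this
    dsimp only at this
    omega
  have key : ∀ v, 0 ≤ v → rootSum c 0 + (k + 1) * v ≤ a + k * v := by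
    intro v hv
    refine le_trans ?_ (h.rootSum_le h1 ha v)
    have h2 := Finset.sum_le_sum fun i (_ : i ∈ Finset.univ) => le_minReal (c := c i) hv
    rw [Finset.sum_add_distrib, ← Finset.sum_mul, Finset.sum_boole] at h2
    refine le_trans ?_ h2
    have h3 : ((k + 1 : ℕ) : ℝ) ≤ ((Finset.univ.filter fun i => c i = 0).card : ℝ) := by
      exact_mod_cast hcard
    push_cast at h3
    have := mul_le_mul_of_nonneg_right h3 hv
    rw [rootSum]
    linarith
  have h2 := key (max 0 (a - rootSum c 0) + 1) (by positivity)
  linarith [le_max_right 0 (a - rootSum c 0)]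

namespace CoeffsWithEquivalents

variable {Q : ModGerm[X]} {p : ℂ[X]} {P : Rmin[X]} {c : Fin n → Rmin}

theorem coeff_le_exponentPoly (h : CoeffsWithEquivalents Q p P c) (hdeg : Q.natDegree = n) (j : ℕ) :
    P.coeff j ≤ (exponentPoly Q).coeff j := by
  rw [coeff_exponentPoly]
  rcases le_or_gt j n with hj | hj
  · exact le_exponent (h.equivalent j hj)
  · rw [coeff_eq_zero_of_natDegree_lt (p := Q) (hdeg ▸ hj), exponent_zero]
    exact Tropical.le_zero _

theorem coeff_exponentPoly_eq (h : CoeffsWithEquivalents Q p P c) {j : ℕ} (hj : j ≤ n)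
    (hp : p.coeff j ≠ 0 ∨ P.coeff j = 0) : (exponentPoly Q).coeff j = P.coeff j := by
  rw [coeff_exponentPoly, exponent_eq (h.equivalent j hj) hp]

theorem coeff_exponentPoly_lead (h : CoeffsWithEquivalents Q p P c) :
    (exponentPoly Q).coeff n = 1 := by
  rw [h.coeff_exponentPoly_eq le_rfl (Or.inl (h.lead ▸ one_ne_zero)), h.lead']

theorem natDegree_exponentPoly (h : CoeffsWithEquivalents Q p P c) (hdeg : Q.natDegree = n) :
    (exponentPoly Q).natDegree = n := by
  refine natDegree_eq_of_le_of_coeff_ne_zero ?_ (h.coeff_exponentPoly_lead ▸ one_ne_zero)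
  rw [exponentPoly, hdeg]
  refine natDegree_sum_le_of_forall_le _ _ fun j hj => (natDegree_monomial_le _).trans ?_
  exact Nat.lt_succ_iff.1 (Finset.mem_range.1 hj)

/-- The exponents are at least `P`, with equality at the vertices, where the minimum is attained. At
`+∞` only the constant coefficient counts. -/
theorem eval_exponentPoly (h : CoeffsWithEquivalents Q p P c) (hdeg : Q.natDegree = n) (y : Rmin) :
    (exponentPoly Q).eval y = P.eval y := by
  rcases eq_zero_or_eq_ofReal y with rfl | ⟨v, rfl⟩
  · rw [← coeff_zero_eq_eval_zero, ← coeff_zero_eq_eval_zero]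
    exact h.coeff_exponentPoly_eq (Nat.zero_le n) h.zero
  · apply le_antisymm
    · obtain ⟨h1, h2⟩ := h.vertex_right v
      refine (eval_le_coeff_mul_pow _ _ (countGT c v)).trans_eq ?_
      rw [h.coeff_exponentPoly_eq (countGT_le c v) (Or.inl h1), h2, h.roots.eval_ofReal h.lead',
        ← ofReal_natCast_mul, ← ofReal_add, sub_add_cancel]
    · obtain ⟨j, -, hj⟩ := exists_eval_eq (exponentPoly Q) (ofReal v)
      rw [hj]
      exact (eval_le_coeff_mul_pow P _ j).trans
        (mul_le_mul_of_le (h.coeff_le_exponentPoly hdeg j) le_rfl)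

theorem isMinPlusRoots_exponentPoly (h : CoeffsWithEquivalents Q p P c) (hdeg : Q.natDegree = n) :
    IsMinPlusRoots (exponentPoly Q) c where
  degree_eq := by
    have h1 : exponentPoly Q ≠ 0 := fun h0 => by
      have := h.coeff_exponentPoly_lead
      rw [h0, coeff_zero] at this
      exact zero_ne_one this
    rw [degree_eq_natDegree h1, h.natDegree_exponentPoly hdeg]
  monotone := h.roots.monotone
  eval_eq y := by
    rw [h.eval_exponentPoly hdeg, h.roots.eval_eq, h.coeff_exponentPoly_lead, h.lead']

/-- One inclusion of epigraphs is direct. Conversely, a finite point of index `k < n` lies above the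
edge attached to the root `v` at position `n - 1 - k`, whose end vertices are common to both
polynomials. -/
theorem divex_exponentPoly (h : CoeffsWithEquivalents Q p P c) (hdeg : Q.natDegree = n) :
    divex (exponentPoly Q) = divex P := by
  ext k
  apply toEReal_injective
  rw [toEReal_coeff_divex, toEReal_coeff_divex]
  refine vex_congr ?_ ?_ _
  · rintro ⟨x, r⟩ hx
    obtain ⟨k, -, rfl, hk⟩ := exists_of_toFun_le _ _ _ hx
    refine subset_convexHull ℝ _ ?_
    rw [Set.mem_ofPred_eq, toFun_natCast]
    exact (toEReal_le.2 (h.coeff_le_exponentPoly hdeg k)).trans hk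
  · rintro ⟨x, r⟩ hx
    obtain ⟨k, hkn, hxk, hk⟩ := exists_of_toFun_le _ _ _ hx
    dsimp only at hxk hk
    subst hxk
    rw [h.roots.natDegree_eq] at hkn
    rcases hkn.eq_or_lt with rfl | hkn
    · refine subset_convexHull ℝ _ ?_
      rw [Set.mem_ofPred_eq, toFun_natCast,
        h.coeff_exponentPoly_eq le_rfl (Or.inl (h.lead ▸ one_ne_zero))]
      exact hk
    rcases eq_zero_or_eq_ofReal (P.coeff k) with h0 | ⟨a, ha⟩
    · rw [h0, toEReal_zero, top_le_iff] at hk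
      exact absurd hk (EReal.coe_ne_top r)
    rw [ha, toEReal_ofReal, EReal.coe_le_coe_iff] at hk
    rcases eq_zero_or_eq_ofReal (c ⟨n - 1 - k, by omega⟩) with hc | ⟨v, hv⟩
    · exact absurd (ha.symm.trans (h.roots.coeff_eq_zero h.lead' hkn hc)) (ofReal_ne_zero a)
    have hGT : countGT c v ≤ k := by
      have := (monotone_lt_iff h.roots.monotone v ⟨n - 1 - k, by omega⟩).not.1 hv.le.not_gt
      dsimp only at this
      omega
    have hGE : k + 1 ≤ countGE c v := by
      obtain ⟨l, hl, hgap⟩ := exists_gap_left c v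
      rw [← countGT_eq_countGE c hl hgap]
      have := (monotone_lt_iff h.roots.monotone l ⟨n - 1 - k, by omega⟩).1
        (hv ▸ ofReal_lt.2 hl)
      dsimp only at this
      omega
    have key : ∀ m ≤ n, p.coeff m ≠ 0 ∧ P.coeff m = ofReal (rootSum c v - m * v) → ∀ s, 0 ≤ s →
        ((m : ℝ), rootSum c v - m * v + s) ∈
          {q : ℝ × ℝ | toFun (exponentPoly Q) q.1 ≤ (q.2 : EReal)} := by
      rintro m hm ⟨h1, h2⟩ s hs
      rw [Set.mem_ofPred_eq, toFun_natCast, h.coeff_exponentPoly_eq hm (Or.inl h1), h2,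
        toEReal_ofReal, EReal.coe_le_coe_iff]
      linarith
    refine mem_convexHull_of_line (x₁ := countGT c v) (x₂ := countGE c v) (b := rootSum c v) (v := v)
      (by exact_mod_cast hGT) (by exact_mod_cast (Nat.le_succ k).trans hGE)
      (by exact_mod_cast hGT.trans_lt hGE) ?_ fun s hs =>
        ⟨key _ (countGT_le c v) (h.vertex_right v) s hs, key _ (countGE_le c v) (h.vertex_left v) s hs⟩
    have := h.roots.rootSum_le h.lead' ha v
    linarith

end CoeffsWithEquivalents

/-! ### Comparison of the roots with the Newton polygon -/

/-- The limit of the linear factor of a root `∼ y ε ^ Y` at the scale `ε ^ v`. -/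
def limitFactor (v : ℝ) (y : ℂ) (Y : Rmin) : ℂ[X] :=
  if ofReal v < Y then X else if Y = ofReal v then X - C y else C (-y)

/-- In `ε ^ v z - f ε` the term of smaller exponent prevails, and both survive when `Y = v`. -/
theorem tendsto_factor {f : ModGerm} {y : ℂ} {Y : Rmin} (h : HasFirstOrderAsymptotics f y Y)
    (v : ℝ) (z : ℂ) :
    Tendsto (fun ε : ℝ => ((ε ^ (-minReal v Y) : ℝ) : ℂ) * (((ε ^ v : ℝ) : ℂ) * z - germVal f ε))
      (𝓝[>] 0) (𝓝 ((limitFactor v y Y).eval z)) := by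
  have hsplit : ∀ s : ℝ, (fun ε : ℝ => ((ε ^ (v - s) : ℝ) : ℂ) * z -
      ((ε ^ (-s) : ℝ) : ℂ) * germVal f ε) =ᶠ[𝓝[>] 0]
      fun ε : ℝ => ((ε ^ (-s) : ℝ) : ℂ) * (((ε ^ v : ℝ) : ℂ) * z - germVal f ε) := by
    intro s
    filter_upwards [eventually_pos] with ε hε
    rw [sub_eq_add_neg v s, Real.rpow_add hε]
    push_cast
    ring
  have hconst : Tendsto (fun ε : ℝ => ((ε ^ (v - v) : ℝ) : ℂ) * z) (𝓝[>] 0) (𝓝 z) := by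
    simp
  by_cases h1 : ofReal v < Y
  · have h2 : minReal v Y = v := by
      rw [← ofReal_inj, ofReal_minReal, Tropical.add_eq_left h1.le]
    rw [h2, limitFactor, if_pos h1, eval_X]
    simpa using (hconst.sub (h.weakEquiv.tendsto_of_lt h1)).congr' (hsplit v)
  · rcases h with ⟨h2, -⟩ | ⟨s, rfl, -, h2⟩
    · exact absurd (h2 ▸ ofReal_lt_zero v) h1
    · rw [ofReal_lt, not_lt] at h1
      rw [minReal_ofReal, min_eq_right h1, limitFactor, if_neg (by rw [ofReal_lt]; exact h1.not_gt)]
      rcases h1.eq_or_lt with rfl | h1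
      · rw [if_pos rfl, eval_sub, eval_X, eval_C]
        exact (hconst.sub h2).congr' (hsplit s)
      · rw [if_neg fun h => h1.ne (ofReal_inj.1 h), eval_C]
        have h3 := (tendsto_rpow_zero (sub_pos.2 h1)).mul_const z
        rw [zero_mul] at h3
        simpa using (h3.sub h2).congr' (hsplit s)

theorem limitFactor_ne_zero {f : ModGerm} {y : ℂ} {Y : Rmin} (h : HasFirstOrderAsymptotics f y Y)
    (v : ℝ) : limitFactor v y Y ≠ 0 := by
  rw [limitFactor]
  split_ifs with h1 h2
  · exact X_ne_zero
  · exact X_sub_C_ne_zero y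
  · refine C_ne_zero.2 (neg_ne_zero.2 (h.ne_zero fun h0 => h1 ?_))
    exact h0 ▸ ofReal_lt_zero v

theorem filter_roots_limitFactor {f : ModGerm} {y : ℂ} {Y : Rmin}
    (h : HasFirstOrderAsymptotics f y Y) (v : ℝ) :
    (limitFactor v y Y).roots.filter (fun z => z ≠ 0) = if Y = ofReal v then {y} else 0 := by
  rw [limitFactor]
  split_ifs with h1 h2 h2
  · exact absurd h2 h1.ne'
  · simp [Multiset.filter_singleton]
  · have := h.ne_zero (h2 ▸ ofReal_ne_zero v)
    simp [Multiset.filter_singleton, this]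
  · simp

namespace RootsWithAsymptotics

variable {Q : ModGerm[X]} {rt : Fin n → ModGerm} {y : Fin n → ℂ} {Y : Fin n → Rmin}

theorem tendsto_eval (h : RootsWithAsymptotics Q rt y Y) (hdeg : Q.natDegree = n)
    (hlead : Q.coeff n = 1) (v : ℝ) (z : ℂ) :
    Tendsto (fun ε : ℝ => ((ε ^ (-rootSum Y v) : ℝ) : ℂ) *
        (evalAt Q ε).eval (((ε ^ v : ℝ) : ℂ) * z))
      (𝓝[>] 0) (𝓝 ((∏ i, limitFactor v (y i) (Y i)).eval z)) := by
  rw [eval_prod]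
  refine (tendsto_finsetProd _ fun i _ => tendsto_factor (h.asymptotics i) v z).congr' ?_
  filter_upwards [(roots_evalAt_iff hdeg hlead fun ε j => germVal (rt j) ε).1 h.roots_eq,
    eventually_pos] with ε hε h0
  rw [hε, rootPoly_eval, Finset.prod_mul_distrib, ← Complex.ofReal_prod,
    ← Real.rpow_sum_of_pos h0, Finset.sum_neg_distrib, rootSum]

/-- The same rescaled polynomial has a nonzero limit under each of the two normalizations. If the
exponents differed, the limit for the smaller one would be `ε ^ (t - s) → 0` times a convergent
quantity, hence zero. -/
theorem rootSum_eq_and_saturated_eq (h : RootsWithAsymptotics Q rt y Y) {p : ℂ[X]} {P : Rmin[X]}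
    {c : Fin n → Rmin} (h' : CoeffsWithEquivalents Q p P c) (hdeg : Q.natDegree = n)
    (hlead : Q.coeff n = 1) (v : ℝ) :
    rootSum c v = rootSum Y v ∧
      saturated n p P (ofReal v) = ∏ i, limitFactor v (y i) (Y i) := by
  have hne : ∏ i, limitFactor v (y i) (Y i) ≠ 0 :=
    Finset.prod_ne_zero_iff.2 fun i _ => limitFactor_ne_zero (h.asymptotics i) v
  have key : ∀ (s t : ℝ) (q₁ q₂ : ℂ[X]), s < t →
      (∀ z, Tendsto (fun ε : ℝ => ((ε ^ (-s) : ℝ) : ℂ) *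
        (evalAt Q ε).eval (((ε ^ v : ℝ) : ℂ) * z)) (𝓝[>] 0) (𝓝 (q₁.eval z))) →
      (∀ z, Tendsto (fun ε : ℝ => ((ε ^ (-t) : ℝ) : ℂ) *
        (evalAt Q ε).eval (((ε ^ v : ℝ) : ℂ) * z)) (𝓝[>] 0) (𝓝 (q₂.eval z))) → q₁ = 0 := by
    intro s t q₁ q₂ hst h1 h2
    refine Polynomial.funext fun z => ?_
    have h3 := (tendsto_rpow_zero (sub_pos.2 hst)).mul (h2 z)
    rw [zero_mul] at h3
    rw [eval_zero]
    refine tendsto_nhds_unique (h1 z) (h3.congr' ?_)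
    filter_upwards [eventually_pos] with ε hε
    rw [← mul_assoc, ← Complex.ofReal_mul, ← Real.rpow_add hε]
    congr 3; ring
  have h1 := h'.tendsto_eval hdeg v
  have h2 := h.tendsto_eval hdeg hlead v
  have heq : rootSum c v = rootSum Y v := by
    rcases lt_trichotomy (rootSum c v) (rootSum Y v) with h3 | h3 | h3
    · exact absurd (key _ _ _ _ h3 h1 h2) (h'.saturated_ne_zero v)
    · exact h3
    · exact absurd (key _ _ _ _ h3 h2 h1) hne
  refine ⟨heq, Polynomial.funext fun z => ?_⟩
  rw [heq] at h1
  exact tendsto_nhds_unique (h1 z) (h2 z)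

end RootsWithAsymptotics

end NewtonPuiseux

end

theorem mainTheorem1 (n : ℕ) (Q : ModGerm[X]) (hdeg : Q.natDegree ≤ n) (hlead : Q.coeff n = 1) :
    ((∃ (rt : Fin n → ModGerm) (y : Fin n → ℂ) (Y : Fin n → Rmin),
        RootsWithAsymptotics Q rt y Y) ↔
      ∃ (p : ℂ[X]) (P : Rmin[X]) (c : Fin n → Rmin), CoeffsWithEquivalents Q p P c) ∧
    ∀ (rt : Fin n → ModGerm) (y : Fin n → ℂ) (Y : Fin n → Rmin)
      (p : ℂ[X]) (P : Rmin[X]) (c : Fin n → Rmin),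
      RootsWithAsymptotics Q rt y Y → CoeffsWithEquivalents Q p P c →
        (∀ j, P.coeff j ≤ (exponentPoly Q).coeff j) ∧
        divex (exponentPoly Q) = divex P ∧
        IsMinPlusRoots (exponentPoly Q) c ∧
        c = Y ∧
        ∀ r : ℝ, (∃ i, c i = ofReal r) →
          (Finset.univ.filter (fun j => c j = ofReal r)).val.map y =
            (saturated n p P (ofReal r)).roots.filter (fun z => z ≠ 0) := by
  have hn := natDegree_eq_of_lead hdeg hlead
  refine ⟨⟨fun ⟨_, _, _, h⟩ => h.exists_coeffsWithEquivalents hn hlead,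
    fun ⟨_, _, _, h⟩ => h.exists_rootsWithAsymptotics hn hlead⟩, ?_⟩
  intro rt y Y p P c h h'
  have hcY : c = Y := eq_of_rootSum_eq h'.roots.monotone h.monotone fun v =>
    (h.rootSum_eq_and_saturated_eq h' hn hlead v).1
  refine ⟨h'.coeff_le_exponentPoly hn, h'.divex_exponentPoly hn, h'.isMinPlusRoots_exponentPoly hn,
    hcY, fun r _ => ?_⟩
  have hne : ∏ i, limitFactor r (y i) (Y i) ≠ 0 :=
    Finset.prod_ne_zero_iff.2 fun i _ => limitFactor_ne_zero (h.asymptotics i) r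
  -- The saturated polynomial is a product of limit factors, and only those with `Yᵢ = r` have a
  -- nonzero root, namely `yᵢ`.
  rw [(h.rootSum_eq_and_saturated_eq h' hn hlead r).2, roots_prod _ _ hne, Multiset.filter_bind,
    Multiset.bind_congr fun i _ => filter_roots_limitFactor (h.asymptotics i) r,
    ← Multiset.bind_filter, Multiset.bind_singleton, hcY, Finset.filter_val]
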